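/- **Setting.** A thinker is a map $f:\{0,1\}^*\to\{0,1\}$; iterating $x\mapsto [x,f(x)]$ for $t$ steps and taking the last bit gives $f^{\mathrm{e2e},t}(x)$, and $f^{\mathrm{CoT},T}(x)=[f^{\mathrm{e2e},1}(x),\dots,f^{\mathrm{e2e},T}(x)]$. For $w\in\mathbb R^d$ let $f_w(z)=\mathbf 1\{\sum_{i=1}^{\min(d,|z|)} w[-i]\,z[-i]\ge 0\}$, where $[-i]$ denotes the $i$-th coordinate from the end; let $\mathcal F_{d,\mathrm{lin}}=\{f_w: w\in\mathbb R^d\}$ and $\mathcal F_{d,\mathrm{lin}}^{\mathrm{e2e},T}=\{f^{\mathrm{e2e},T}: f\in\mathcal F_{d,\mathrm{lin}}\}$, with domain $\mathcal X_d=\{0,1\}^{\le d}$. **Supervision by $\kappa$ thinkers under uniform sampling with unknown identities.** An adversary fixes a distribution $D$ supported on $\mathcal X_d$, some $h_*\in\mathcal F_{d,\mathrm{lin}}^{\mathrm{e2e},T}$ and $f_1,\dots,f_\kappa\in\mathcal F_{d,\mathrm{lin}}$ with $f_j^{\mathrm{e2e},T}=h_*$ for all $j$. The learner receives i.i.d.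 examples $(x^{(i)},f_{j^{(i)}}^{\mathrm{CoT},T}(x^{(i)}))$ with $x^{(i)}\sim D$ and, independently, $j^{(i)}\sim\mathrm{Unif}([\kappa])$; the $j^{(i)}$ are not shown to it. It is a randomized algorithm that outputs a representation of a hypothesis $\hat h$; its running time includes both training and evaluating $\hat h$ on an instance, and it uses polynomially many examples in $d$. A $\mathrm{poly}(d)$-time algorithm *weakly learns $\mathcal F_{d,\mathrm{lin}}^{\mathrm{e2e},T(d)}$ from the CoT supervision of $\kappa(d)$ thinkers for all $T(d),\kappa(d)\le g(d)$* if there are constants $\varepsilon<\tfrac12$, $\delta<1$ such that for all sufficiently large $d$, all $1\le T,\kappa\le g(d)$ and every choice of the adversary, it satisfies $\Pr_{x\sim D}[\hat h(x)\ne h_*(x)]\le\varepsilon$ with probability at least $1-\delta$ over the training set and its own coins. **Assumption (local PRGs with polynomial stretch exist).** For every constant $s>1$ there are a constant $K$ and a predicate $P:\{0,1\}^K\to\{0,1\}$ such that, with $M=\lfloor N^s\rfloor$, every probabilistic polynomial-time algorithm $A$ satisfies, for all sufficiently large $N$, $$\Bigl|\Pr_{G,x}[A(G,f_{P,G}(x))=1]-\Pr_{G,y}[A(G,y)=1]\Bigr|\le\tfrac13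 .$$ Here $G=(S_1,\dots,S_M)$ consists of independent uniform ordered $K$-tuples of distinct elements of $[N]$, $x\in\{0,1\}^N$ and $y\in\{0,1\}^M$ are uniform, and $f_{P,G}(x)=(P(x_{S_1}),\dots,P(x_{S_M}))$. **Theorem.** Assume that local PRGs with polynomial stretch exist. Then for every non-decreasing sequence $g:\mathbb N\to\mathbb N$ with $g(d)\to\infty$ (that is, $g(d)=\omega_d(1)$) that is computable in $\mathrm{poly}(d)$ time, there is no $\mathrm{poly}(d)$-time algorithm that weakly learns $\mathcal F_{d,\mathrm{lin}}^{\mathrm{e2e},T(d)}$ from the CoT supervision of $\kappa(d)$ thinkers, for all $T(d),\kappa(d)\le g(d)$, under uniform sampling with unknown identities. -/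

import Mathlib

namespace Thinkers

/-! ### Autoregressive thinkers -/

/-- A sequence-to-next-token generator. Strings are read from left to right, so the last token is
the last entry of the list. -/
abbrev Thinker : Type := List Bool → Bool

/-- The apply-and-append map of a thinker. -/
def applyAppend (f : Thinker) (x : List Bool) : List Bool := x ++ [f x]

/-- The end-to-end map: the last token after `T` autoregressive steps (meaningful for `1 ≤ T`). -/
def e2e (f : Thinker) (T : ℕ) (x : List Bool) : Bool := ((applyAppend f)^[T] x).getLastD false

/-- The chain of thought of length `T`: the end-to-end values after `1, …, T` steps. -/
def cot (f : Thinker) (T : ℕ) (x : List Bool) : List Bool :=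
  (List.range T).map fun t => e2e f (t + 1) x

/-- The linear threshold with window `d` and weights `w`. Counting from the end, the weight
`w i.rev` is the `(i+1)`-st weight and `z.reverse.getD i false` is the `(i+1)`-st token; positions
beyond the length of `z` contribute `0`. -/
noncomputable def linThinker {d : ℕ} (w : Fin d → ℝ) : Thinker := fun z =>
  decide (0 ≤ ∑ i : Fin d, w i.rev * ((z.reverse.getD i false).toNat : ℝ))

/-- The base class of all linear thresholds of window size `d`. -/
def linClass (d : ℕ) : Set Thinker := {f | ∃ w : Fin d → ℝ, f = linThinker w}

/-- The end-to-end class of a base class. -/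
def e2eClass (F : Set Thinker) (T : ℕ) : Set (List Bool → Bool) := {h | ∃ f ∈ F, h = e2e f T}

/-! ### Machine model: structured programs over finitely many stacks of bits, one unit of time per
step (polynomially equivalent to multi-tape Turing machines) -/

/-- Programs of a machine whose memory consists of stacks of bits indexed by `ℕ`. A program
mentions only finitely many stacks. -/
inductive Prog : Type
  | skip : Prog
  | push (i : ℕ) (b : Bool) : Prog
  | pop (i : ℕ) : Prog
  | seq (p q : Prog) : Prog
  /-- Branch on stack `i`: run `p` if it is empty, `q` if its top is `false`, `r` if it is
  `true`. -/
  | branch (i : ℕ) (p q r : Prog) : Prog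
  /-- While stack `i` is not empty, run `p`. -/
  | loop (i : ℕ) (p : Prog) : Prog

/-- The memory: the content of each stack, top first. -/
abbrev Memory : Type := ℕ → List Bool

/-- A configuration: the programs that remain to be run, in order, and the memory. The machine has
halted when nothing remains to be run. -/
abbrev Config : Type := List Prog × Memory

/-- One step of computation. -/
def step : Config → Config
  | ([], m) => ([], m)
  | (Prog.skip :: k, m) => (k, m)
  | (Prog.push i b :: k, m) => (k, Function.update m i (b :: m i))
  | (Prog.pop i :: k, m) => (k, Function.update m i (m i).tail)
  | (Prog.seq p q :: k, m) => (p :: q :: k, m)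
  | (Prog.branch i p q r :: k, m) =>
      match m i with
      | [] => (p :: k, m)
      | false :: _ => (q :: k, m)
      | true :: _ => (r :: k, m)
  | (Prog.loop i p :: k, m) =>
      match m i with
      | [] => (k, m)
      | _ :: _ => (p :: Prog.loop i p :: k, m)

/-- The configuration after `t` steps, when stack `i` initially holds the `i`-th input and all
other stacks are empty. -/
def Prog.run (p : Prog) (input : List (List Bool)) (t : ℕ) : Config :=
  step^[t] ([p], fun i => input.getD i [])

/-- The program halts on the input within `t` steps. -/
def Prog.HaltsIn (p : Prog) (input : List (List Bool)) (t : ℕ) : Prop := (p.run input t).1 = []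

/-- The output: the content of stack `0` after `t` steps (used for programs that have halted by
then; a halted machine no longer changes its memory). -/
def Prog.output (p : Prog) (input : List (List Bool)) (t : ℕ) : List Bool := (p.run input t).2 0

/-- The number `n` in unary. -/
def unary (n : ℕ) : List Bool := List.replicate n true

/-- A sequence of natural numbers is computable in `poly(d)` time: on input `d` in unary, the
binary digits of `g d` (least significant first) are computed in a number of steps polynomial
in `d`. -/
def PolyTimeComputable (g : ℕ → ℕ) : Prop :=
  ∃ (p : Prog) (τ : Polynomial ℕ), ∀ d,
    p.HaltsIn [unary d] (τ.eval d) ∧ p.output [unary d] (τ.eval d) = Nat.bits (g d)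

/-! ### Local pseudorandom generators -/

/-- The probability of an event under the uniform distribution on a finite type. -/
noncomputable def uprob (α : Type) (E : α → Prop) : ℝ := (Nat.card {a // E a} : ℝ) / Nat.card α

/-- An `(N, M, K)`-hypergraph: `M` ordered hyperedges, each with `K` distinct vertices. -/
abbrev Hypergraph (N M K : ℕ) : Type := Fin M → (Fin K ↪ Fin N)

/-- Goldreich's generator. -/
def goldreich {N M K : ℕ} (P : (Fin K → Bool) → Bool) (G : Hypergraph N M K) (x : Fin N → Bool) :
    Fin M → Bool := fun i => P fun k => x (G i k)

/-- The input of a distinguisher: `N` in unary, the vertices of the hyperedges in order (the vertex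
`v` as `v` ones followed by a zero), the string `y`, and the random coins `r`. -/
def prgInput {N M K q : ℕ} (G : Hypergraph N M K) (y : Fin M → Bool) (r : Fin q → Bool) :
    List (List Bool) :=
  [unary N,
   (List.ofFn fun i => (List.ofFn fun k => unary (G i k) ++ [false]).flatten).flatten,
   List.ofFn y,
   List.ofFn r]

/-- Goldreich's generators with predicate `P` and `⌊N ^ s⌋` output bits form an `ε`-pseudorandom
generator: every probabilistic polynomial-time algorithm (a program `A` with `q N` uniform coins
and running time `τ N`; it answers `1` by the output `[true]`) has distinguishing advantage at most
`ε` for all large `N`. -/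
def IsPRG {K : ℕ} (P : (Fin K → Bool) → Bool) (s ε : ℝ) : Prop :=
  ∀ (A : Prog) (q τ : Polynomial ℕ),
    (∀ (N : ℕ) (G : Hypergraph N ⌊(N : ℝ) ^ s⌋₊ K) (y : Fin ⌊(N : ℝ) ^ s⌋₊ → Bool)
      (r : Fin (q.eval N) → Bool), A.HaltsIn (prgInput G y r) (τ.eval N)) →
    ∀ᶠ N : ℕ in Filter.atTop,
      |uprob (Hypergraph N ⌊(N : ℝ) ^ s⌋₊ K × (Fin N → Bool) × (Fin (q.eval N) → Bool))
          (fun ω => A.output (prgInput ω.1 (goldreich P ω.1 ω.2.1) ω.2.2) (τ.eval N) = [true]) -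
        uprob (Hypergraph N ⌊(N : ℝ) ^ s⌋₊ K × (Fin ⌊(N : ℝ) ^ s⌋₊ → Bool) ×
            (Fin (q.eval N) → Bool))
          (fun ω => A.output (prgInput ω.1 ω.2.1 ω.2.2) (τ.eval N) = [true])| ≤ ε

/-- Local PRGs with polynomial stretch exist. -/
def LocalPRGsExist : Prop :=
  ∀ s : ℝ, 1 < s → ∃ (K : ℕ) (P : (Fin K → Bool) → Bool), IsPRG P s (1 / 3)

/-! ### Learning from chain-of-thought supervision, uniform sampling, unknown identities -/

/-- A list of `n` independent samples. -/
noncomputable def iid {α : Type} (p : PMF α) : ℕ → PMF (List α)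
  | 0 => PMF.pure []
  | n + 1 => p.bind fun a => (iid p n).map fun l => a :: l

/-- One training example: an instance `x ∼ D` and the chain of thought on `x` of one of the `κ`
thinkers, chosen uniformly and independently of `x`; the identity of the thinker is not shown. -/
noncomputable def cotExample (D : PMF (List Bool)) {κ : ℕ} [NeZero κ] (f : Fin κ → Thinker)
    (T : ℕ) : PMF (List Bool × List Bool) :=
  D.bind fun x => (PMF.uniformOfFintype (Fin κ)).map fun j => (x, cot (f j) T x)

/-- The error of a predictor. -/
noncomputable def err (D : PMF (List Bool)) (h hhat : List Bool → Bool) : ENNReal :=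
  D.toOuterMeasure {x | hhat x ≠ h x}

/-- A self-delimiting code of a string: each bit is preceded by `true`, the end is `false`. -/
def encodeString (x : List Bool) : List Bool := x.flatMap (fun b => [true, b]) ++ [false]

/-- The code of a training set. -/
def encodeSample (S : List (List Bool × List Bool)) : List Bool :=
  S.flatMap fun e => encodeString e.1 ++ encodeString e.2

/-- A randomized learning algorithm: a program `train` that maps a training set and random coins to
a representation of a hypothesis, a program `predict` that evaluates a represented hypothesis on an
instance, and polynomials in `d` that give the number of examples and of coins supplied (the
algorithm need not read all of them) and the running time of both programs. -/
structure Learner : Type where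
  train : Prog
  predict : Prog
  samples : Polynomial ℕ
  coins : Polynomial ℕ
  time : Polynomial ℕ

namespace Learner

/-- The input of the training program: `d` in unary, `T` and `κ` in binary, the training set and
the coins. -/
def trainInput (d T κ : ℕ) (S : List (List Bool × List Bool)) (r : List Bool) :
    List (List Bool) :=
  [unary d, Nat.bits T, Nat.bits κ, encodeSample S, r]

/-- The representation of the hypothesis learned from the training set `S` with coins `r`. -/
def rep (L : Learner) (d T κ : ℕ) (S : List (List Bool × List Bool)) (r : List Bool) : List Bool :=
  L.train.output (trainInput d T κ S r) (L.time.eval d)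

/-- The hypothesis represented by `c`. -/
def hyp (L : Learner) (d : ℕ) (c : List Bool) (x : List Bool) : Bool :=
  decide (L.predict.output [c, x] (L.time.eval d) = [true])

/-- For the parameters `d, T, κ`, training and prediction respect the time bound, whatever the
training set, the coins, and the instance to be labelled. -/
def RunsInTime (L : Learner) (d T κ : ℕ) : Prop :=
  ∀ (S : List (List Bool × List Bool)) (r : List Bool),
    S.length = L.samples.eval d → (∀ e ∈ S, e.1.length ≤ d ∧ e.2.length = T) →
    r.length = L.coins.eval d →
    L.train.HaltsIn (trainInput d T κ S r) (L.time.eval d) ∧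
    ∀ x : List Bool, x.length ≤ d →
      L.predict.HaltsIn [L.rep d T κ S r, x] (L.time.eval d)

/-- The distribution of the learned hypothesis (its representation), when the learner is given
i.i.d. examples from the distribution `E` and uniform coins. -/
noncomputable def learned (L : Learner) (d T κ : ℕ) (E : PMF (List Bool × List Bool)) :
    PMF (List Bool) :=
  (iid E (L.samples.eval d)).bind fun S =>
    (iid (PMF.uniformOfFintype Bool) (L.coins.eval d)).map fun r => L.rep d T κ S r

/-- For the parameters `d, T, κ`, the learner learns the class `e2eClass (linClass d) T` over the
domain of strings of length at most `d`, from the chain-of-thought supervision of `κ` thinkers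
under uniform sampling with unknown identities, to accuracy `ε` with confidence `1 - δ`. -/
def Learns (L : Learner) (ε δ : ℝ) (d T κ : ℕ) [NeZero κ] : Prop :=
  ∀ D : PMF (List Bool), (∀ x ∈ D.support, x.length ≤ d) →
  ∀ h ∈ e2eClass (linClass d) T,
  ∀ f : Fin κ → Thinker, (∀ j, f j ∈ linClass d) → (∀ j, e2e (f j) T = h) →
    ENNReal.ofReal (1 - δ) ≤
      (L.learned d T κ (cotExample D f T)).toOuterMeasure
        {c | err D h (L.hyp d c) ≤ ENNReal.ofReal ε}

/-- The learner is a `poly(d)`-time weak learner for all thinking lengths `T` and numbers of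
thinkers `κ` that are at most `g d`: for some constants `ε < 1 / 2` and `δ < 1` and all large `d`,
it runs in its polynomial time and learns to accuracy `ε` with confidence `1 - δ`. -/
def WeaklyLearns (L : Learner) (g : ℕ → ℕ) : Prop :=
  ∃ ε δ : ℝ, 0 < ε ∧ ε < 1 / 2 ∧ 0 < δ ∧ δ < 1 ∧
    ∀ᶠ d : ℕ in Filter.atTop, ∀ (T κ : ℕ) [NeZero κ], 1 ≤ T → T ≤ g d → κ ≤ g d →
      L.RunsInTime d T κ ∧ L.Learns ε δ d T κ

end Learner

end Thinkers

/-! Suppose a learner `L` exists. It is turned into a distinguisher against Goldreich's generator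
with some predicate `P` of locality `K`, and the thinking length and the number of thinkers are both
taken to be `2 ^ K`. A seed `x` plays the role of the unknown target, a random hyperedge `e` is a
random instance, and the label is `P` of the seed restricted to `e`.

Three things make this work. First, a chain of thought of linear thresholds can compute any `P` of
constant locality: in each step the thinker tests one assignment `a` with `P a` against the
restricted seed. A single weight vector serves all steps, since every new token shifts the input by
one place. If the input occupies only the places divisible by `T + 1`, step `s` sees only the
weights of residue `s`, so the steps have independent weights. Large weights on the recent places
make a token `true` persist, so the chain is a disjunction (`e2e_eq_exists`, `form_of_clean`).

Second, thinker `j` runs through the assignments cyclically, starting at number `j`. All thinkers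
have the same end-to-end map; this is needed on every string, so strings that are not of the
prescribed shape are detected and always answered `true` (`e2e_seedThinker_eq`). The chain of
thought shows only the label and a delay, namely the index of the restricted seed minus `j` modulo
`2 ^ K`. For uniform `j` the delay is uniform whatever the seed. Supervision by anonymous thinkers
therefore has the law of something drawn from the label and `K` coins
(`simulatedExample_labelledEdge`).

Third, the distinguisher simulates a training set from the given labels, trains, and counts the
correct predictions on `n` fresh labelled hyperedges. On pseudorandom labels the learner's guarantee
makes the count large with constant probability; on random labels every prediction is right with
probability one half (`rejectProb_labelledEdge`, `one_le_rejectProb_add`). A constant number of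
independent rounds raises the advantage above one third. The stretch is chosen from the degree of
the sample polynomial alone, and `K` is obtained afterwards. Hence `2 ^ K` is a constant, eventually
below `g`.

A large part of the file writes this distinguisher as a stack program with a polynomial time bound
(`exists_distinguisher`). -/

namespace Thinkers

/-! ### Disjunctions computed by chains of thought -/

/-- The `i`-th token from the end, as a number. -/
noncomputable def bit (z : List Bool) (i : ℕ) : ℝ := ((z.reverse.getD i false).toNat : ℝ)

lemma bit_nonneg (z : List Bool) (i : ℕ) : 0 ≤ bit z i := by unfold bit; positivity

lemma bit_le_one (z : List Bool) (i : ℕ) : bit z i ≤ 1 := by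
  unfold bit
  cases z.reverse.getD i false <;> simp

lemma bit_append_zero (z : List Bool) (b : Bool) : bit (z ++ [b]) 0 = (b.toNat : ℝ) := by
  simp [bit]

lemma bit_append_succ (z : List Bool) (b : Bool) (i : ℕ) : bit (z ++ [b]) (i + 1) = bit z i := by
  simp [bit]

/-- The linear form with weight `ω i` on the `i`-th token from the end. -/
noncomputable def form (d : ℕ) (ω : ℕ → ℝ) (z : List Bool) : ℝ :=
  ∑ i ∈ Finset.range d, ω i * bit z i

/-- The linear thinker with weight `ω i` on the `i`-th token from the end. -/
noncomputable def revThinker (d : ℕ) (ω : ℕ → ℝ) : Thinker :=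
  linThinker (d := d) fun i => ω i.rev

lemma revThinker_mem (d : ℕ) (ω : ℕ → ℝ) : revThinker d ω ∈ linClass d := ⟨_, rfl⟩

lemma revThinker_apply (d : ℕ) (ω : ℕ → ℝ) (z : List Bool) :
    revThinker d ω z = decide (0 ≤ form d ω z) := by
  simp only [revThinker, linThinker, form, Finset.sum_range, Fin.rev_rev, bit]

lemma form_append {d : ℕ} {ω : ℕ → ℝ} (hω : ∀ i, d ≤ i → ω i = 0) (z : List Bool) (b : Bool) :
    form d ω (z ++ [b]) = ω 0 * (b.toNat : ℝ) + form d (fun i => ω (i + 1)) z := by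
  have h : form d ω (z ++ [b]) = ∑ i ∈ Finset.range (d + 1), ω i * bit (z ++ [b]) i := by
    rw [Finset.sum_range_succ, hω d le_rfl, zero_mul, add_zero, form]
  rw [h, Finset.sum_range_succ', form, bit_append_zero, add_comm]
  simp only [bit_append_succ]

lemma e2e_succ (f : Thinker) (t : ℕ) (x : List Bool) :
    e2e f (t + 1) x = f ((applyAppend f)^[t] x) := by
  rw [e2e, Function.iterate_succ_apply']
  simp [applyAppend]

/-- After `t` steps the newest token is at place `0`, the token of step `s + 1` at place `t - 1 -
s`, and the whole input has moved `t` places back. -/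
lemma form_iterate {d : ℕ} (f : Thinker) (x : List Bool) (t : ℕ) :
    ∀ {ω : ℕ → ℝ}, (∀ i, d ≤ i → ω i = 0) →
    form d ω ((applyAppend f)^[t] x) =
      ∑ s ∈ Finset.range t, ω (t - 1 - s) * ((e2e f (s + 1) x).toNat : ℝ) +
        form d (fun i => ω (i + t)) x := by
  induction t with
  | zero => intro ω _; simp
  | succ t ih =>
    intro ω hω
    rw [Function.iterate_succ_apply', applyAppend, form_append hω, ← e2e_succ f t x,
      ih (ω := fun i => ω (i + 1)) (fun i hi => hω _ (by omega)), Finset.sum_range_succ]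
    have h1 : ∀ s ∈ Finset.range t, ω (t - 1 - s + 1) * ((e2e f (s + 1) x).toNat : ℝ) =
        ω (t + 1 - 1 - s) * ((e2e f (s + 1) x).toNat : ℝ) := by
      intro s hs
      rw [Finset.mem_range] at hs
      congr 2; omega
    rw [Finset.sum_congr rfl h1]
    have h2 : (fun i => ω (i + t + 1)) = fun i => ω (i + (t + 1)) := by
      funext i; rw [add_assoc]
    rw [h2]
    simp only [Nat.add_sub_cancel, Nat.sub_self]
    ring

lemma neg_le_form {d : ℕ} {ω : ℕ → ℝ} (hneg : ∀ i, -1 ≤ ω i) (x : List Bool) :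
    -(d : ℝ) ≤ form d ω x := by
  have : ∑ _i ∈ Finset.range d, (-1 : ℝ) ≤ form d ω x := by
    refine Finset.sum_le_sum fun i _ => ?_
    nlinarith [hneg i, bit_nonneg x i, bit_le_one x i]
  simpa using this

/-- If the weights of the most recent tokens are large, a thinker computes the disjunction of the
shifted thresholds, since a token `true` is repeated forever. -/
lemma e2e_eq_exists {d T : ℕ} {ω : ℕ → ℝ} (hsupp : ∀ i, d ≤ i → ω i = 0) (hneg : ∀ i, -1 ≤ ω i)
    (hpos : ∀ i < T, (d : ℝ) ≤ ω i) (x : List Bool) (t : ℕ) (ht : t < T) :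
    e2e (revThinker d ω) (t + 1) x = true ↔ ∃ s ≤ t, 0 ≤ form d (fun i => ω (i + s)) x := by
  induction t using Nat.strong_induction_on with
  | _ t ih =>
  rw [e2e_succ, revThinker_apply, decide_eq_true_iff, form_iterate _ _ _ hsupp]
  by_cases hex : ∃ s < t, 0 ≤ form d (fun i => ω (i + s)) x
  · obtain ⟨s, hs, hs0⟩ := hex
    refine ⟨fun _ => ⟨s, hs.le, hs0⟩, fun _ => ?_⟩
    have ho : e2e (revThinker d ω) (s + 1) x = true := (ih s hs (hs.trans ht)).2 ⟨s, le_rfl, hs0⟩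
    -- One earlier `true` contributes at least `d` and the other generated tokens nothing negative,
    -- while the input contributes at least `-d`: the output stays `true`.
    have h1 : (d : ℝ) ≤ ∑ s ∈ Finset.range t,
        ω (t - 1 - s) * ((e2e (revThinker d ω) (s + 1) x).toNat : ℝ) := by
      refine le_trans ?_ (Finset.single_le_sum (f := fun s => ω (t - 1 - s) *
        ((e2e (revThinker d ω) (s + 1) x).toNat : ℝ)) (fun r hr => ?_) (Finset.mem_range.2 hs))
      · simpa [ho] using hpos (t - 1 - s) (by omega)
      · exact mul_nonneg ((Nat.cast_nonneg d).trans (hpos _ (by omega))) (Nat.cast_nonneg _)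
    linarith [neg_le_form (d := d) (ω := fun i => ω (i + t)) (fun i => hneg _) x]
  · have h0 : ∑ s ∈ Finset.range t,
        ω (t - 1 - s) * ((e2e (revThinker d ω) (s + 1) x).toNat : ℝ) = 0 := by
      refine Finset.sum_eq_zero fun s hs => ?_
      rw [Finset.mem_range] at hs
      have : e2e (revThinker d ω) (s + 1) x = false := by
        rw [← Bool.not_eq_true, ih s hs (hs.trans ht)]
        rintro ⟨r, hr, hr0⟩
        exact hex ⟨r, by omega, hr0⟩
      simp [this]
    rw [h0, zero_add]
    refine ⟨fun h => ⟨t, le_rfl, h⟩, ?_⟩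
    rintro ⟨s, hs, hs0⟩
    rcases hs.lt_or_eq with h | rfl
    · exact absurd ⟨s, h, hs0⟩ hex
    · exact hs0

/-! ### Shifted thresholds that can be permuted freely -/

/-- The weights, listed from the end, of a thinker whose step `s` evaluates the linear form with
coefficients `W s` at the tokens in the places divisible by `T + 1`, and which notices a token
`true` in any other place. -/
noncomputable def blockWeights (d T n : ℕ) (W : ℕ → ℕ → ℝ) (i : ℕ) : ℝ :=
  if n * (T + 1) ≤ i then 0
  else if i < T + 1 ∨ i % (T + 1) = T then d
  else W (i % (T + 1)) (i / (T + 1))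

/-- All tokens in the first `n` blocks of length `T + 1`, counted from the end, are in the first
place of their block, and not in the first block. -/
def Clean (T n : ℕ) (z : List Bool) : Prop :=
  ∀ i < n * (T + 1), z.reverse.getD i false = true → T + 1 ≤ i ∧ i % (T + 1) = 0

variable {d T n : ℕ} {W : ℕ → ℕ → ℝ}

lemma blockWeights_supp (hd : n * (T + 1) ≤ d) (i : ℕ) (hi : d ≤ i) :
    blockWeights d T n W i = 0 := by
  rw [blockWeights, if_pos (hd.trans hi)]

lemma blockWeights_ge (hW : ∀ s q, -1 ≤ W s q) (i : ℕ) : -1 ≤ blockWeights d T n W i := by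
  have : (0 : ℝ) ≤ d := Nat.cast_nonneg d
  unfold blockWeights
  split_ifs
  · norm_num
  · linarith
  · exact hW _ _

lemma blockWeights_recent (hn : 0 < n) (i : ℕ) (hi : i < T) :
    (d : ℝ) ≤ blockWeights d T n W i := by
  have : T + 1 ≤ n * (T + 1) := Nat.le_mul_of_pos_left _ hn
  rw [blockWeights, if_neg (by omega), if_pos (Or.inl (by omega))]

/-- A misplaced token in the first block already has weight `d`. Any other one has a residue `r ≠
0`, and the shift `T - r < T` brings it to residue `T` inside its block, where the weight is again
`d`. This outweighs all other tokens. -/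
lemma exists_shift_of_not_clean (hd : n * (T + 1) ≤ d) (hT : 0 < T) (hW : ∀ s q, -1 ≤ W s q)
    {z : List Bool} (hz : ¬ Clean T n z) :
    ∃ s < T, 0 ≤ form d (fun i => blockWeights d T n W (i + s)) z := by
  unfold Clean at hz
  push Not at hz
  obtain ⟨i, hi, hb, hg⟩ := hz
  obtain ⟨s, hs, hsn, hsw⟩ : ∃ s < T, i + s < n * (T + 1) ∧
      (i + s < T + 1 ∨ (i + s) % (T + 1) = T) := by
    by_cases h1 : i < T + 1
    · exact ⟨0, hT, by simpa using hi, Or.inl (by simpa using h1)⟩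
    have h0 := hg (by omega)
    have hlt : i % (T + 1) < T + 1 := Nat.mod_lt i (Nat.succ_pos T)
    have hdm := Nat.div_add_mod i (T + 1)
    have hq : i / (T + 1) < n := Nat.div_lt_of_lt_mul (by rwa [mul_comm])
    by_cases h2 : i % (T + 1) = T
    · exact ⟨0, hT, by simpa using hi, Or.inr (by simpa using h2)⟩
    · have he : i + (T - i % (T + 1)) = (T + 1) * (i / (T + 1)) + T := by omega
      refine ⟨T - i % (T + 1), by omega, ?_, Or.inr ?_⟩
      · rw [he]
        have := Nat.mul_le_mul_right (T + 1) hq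
        have h3 : (i / (T + 1)).succ * (T + 1) = (T + 1) * (i / (T + 1)) + T + 1 := by
          rw [Nat.succ_eq_add_one]; ring
        omega
      · rw [he, Nat.mul_add_mod, Nat.mod_eq_of_lt (by omega)]
  refine ⟨s, hs, ?_⟩
  have hid : i ∈ Finset.range d := Finset.mem_range.2 (by omega)
  rw [form, ← Finset.add_sum_erase _ _ hid]
  have hbit : bit z i = 1 := by simp only [bit, hb]; simp
  have hwt : blockWeights d T n W (i + s) = d := by
    rw [blockWeights, if_neg (by omega), if_pos hsw]
  have hrest : ∑ _k ∈ (Finset.range d).erase i, (-1 : ℝ) ≤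
      ∑ k ∈ (Finset.range d).erase i, blockWeights d T n W (k + s) * bit z k := by
    refine Finset.sum_le_sum fun k _ => ?_
    nlinarith [blockWeights_ge (d := d) (T := T) (n := n) hW (k + s), bit_nonneg z k,
      bit_le_one z k]
  have hcard : (((Finset.range d).erase i).card : ℝ) ≤ d := by
    exact_mod_cast (Finset.card_erase_le.trans (Finset.card_range d).le)
  rw [Finset.sum_const, nsmul_eq_mul] at hrest
  rw [hwt, hbit]
  linarith

/-- All relevant tokens sit at multiples of `T + 1`, so after a shift by `s < T` they meet exactly
the weights `W s` and never those of residue `T`. The rows of `W` thus do not interfere. Block `0`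
carries no token, whence the zero at `q = 0`. -/
lemma form_of_clean (hd : n * (T + 1) ≤ d) {z : List Bool} (hz : Clean T n z) {s : ℕ}
    (hs : s < T) :
    form d (fun i => blockWeights d T n W (i + s)) z =
      ∑ q ∈ Finset.range n, W s q * (if q = 0 then 0 else bit z (q * (T + 1))) := by
  have h1 : form d (fun i => blockWeights d T n W (i + s)) z =
      ∑ i ∈ Finset.range (n * (T + 1)), blockWeights d T n W (i + s) * bit z i := by
    rw [form]
    symm
    refine Finset.sum_subset (Finset.range_subset_range.2 hd) fun i _ hi => ?_
    rw [Finset.mem_range, not_lt] at hi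
    rw [blockWeights, if_pos (by omega), zero_mul]
  rw [h1]
  symm
  have hinj : Set.InjOn (fun q => q * (T + 1)) (Finset.range n : Set ℕ) := by
    intro a _ b _ h
    exact Nat.eq_of_mul_eq_mul_right (Nat.succ_pos T) h
  have h2 : ∑ q ∈ Finset.range n, W s q * (if q = 0 then 0 else bit z (q * (T + 1))) =
      ∑ q ∈ Finset.range n, blockWeights d T n W (q * (T + 1) + s) * bit z (q * (T + 1)) := by
    refine Finset.sum_congr rfl fun q hq => ?_
    rw [Finset.mem_range] at hq
    have hqn : (q + 1) * (T + 1) ≤ n * (T + 1) := Nat.mul_le_mul_right _ hq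
    rw [add_mul, one_mul] at hqn
    rcases Nat.eq_zero_or_pos q with rfl | hq0
    · have hb : bit z (0 * (T + 1)) = 0 := by
        have : z.reverse.getD 0 false = false := by
          rw [← Bool.not_eq_true]
          intro h
          have := (hz 0 (by omega) h).1
          omega
        rw [zero_mul, bit, this]; simp
      rw [hb]; simp
    · have hge : T + 1 ≤ q * (T + 1) := Nat.le_mul_of_pos_left _ hq0
      have hmod : (q * (T + 1) + s) % (T + 1) = s := by
        rw [mul_comm, Nat.mul_add_mod, Nat.mod_eq_of_lt (by omega)]
      have hdiv : (q * (T + 1) + s) / (T + 1) = q := by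
        rw [mul_comm, Nat.mul_add_div (by omega), Nat.div_eq_of_lt (by omega), add_zero]
      have hlt : ¬ n * (T + 1) ≤ q * (T + 1) + s := by omega
      have hne : ¬ (q * (T + 1) + s < T + 1 ∨ (q * (T + 1) + s) % (T + 1) = T) := by
        rw [hmod]; omega
      rw [blockWeights, if_neg hlt, if_neg hne, hmod, hdiv, if_neg (by omega)]
  rw [h2, ← Finset.sum_image (s := Finset.range n) (g := fun q => q * (T + 1))
    (f := fun i => blockWeights d T n W (i + s) * bit z i) hinj]
  refine Finset.sum_subset ?_ fun i hi hni => ?_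
  · intro i hi
    obtain ⟨q, hq, rfl⟩ := Finset.mem_image.1 hi
    rw [Finset.mem_range] at hq ⊢
    exact Nat.mul_lt_mul_of_pos_right hq (Nat.succ_pos T)
  · rw [Finset.mem_range] at hi
    have : z.reverse.getD i false = false := by
      rw [← Bool.not_eq_true]
      intro h
      refine hni (Finset.mem_image.2 ⟨i / (T + 1), ?_, ?_⟩)
      · exact Finset.mem_range.2 (Nat.div_lt_of_lt_mul (by rwa [mul_comm]))
      · exact Nat.div_mul_cancel (Nat.dvd_of_mod_eq_zero (hz i hi h).2)
    rw [bit, this]; simp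

/-- The value of a linear form at the marked tokens. -/
noncomputable def blockForm (T n : ℕ) (c : ℕ → ℝ) (z : List Bool) : ℝ :=
  ∑ q ∈ Finset.range n, c q * (if q = 0 then 0 else bit z (q * (T + 1)))

lemma e2e_blockWeights_of_clean (hd : n * (T + 1) ≤ d) (hn : 0 < n) (hW : ∀ s q, -1 ≤ W s q)
    {z : List Bool} (hz : Clean T n z) {t : ℕ} (ht : t < T) :
    e2e (revThinker d (blockWeights d T n W)) (t + 1) z = true ↔
      ∃ s ≤ t, 0 ≤ blockForm T n (W s) z := by
  rw [e2e_eq_exists (blockWeights_supp hd) (blockWeights_ge hW) (blockWeights_recent hn) z t ht]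
  refine exists_congr fun s => and_congr_right fun hs => ?_
  rw [form_of_clean hd hz (by omega), blockForm]

/-- The value does not depend on `W`; this makes thinkers with different `W` agree on strings that
encode nothing. -/
lemma e2e_blockWeights_of_not_clean (hd : n * (T + 1) ≤ d) (hn : 0 < n) (hT : 0 < T)
    (hW : ∀ s q, -1 ≤ W s q) {z : List Bool} (hz : ¬ Clean T n z) :
    e2e (revThinker d (blockWeights d T n W)) T z = true := by
  obtain ⟨t, rfl⟩ := Nat.exists_eq_add_of_lt hT
  rw [zero_add]
  rw [zero_add] at hd hz hT
  rw [e2e_eq_exists (blockWeights_supp hd) (blockWeights_ge hW) (blockWeights_recent hn) z t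
    (by omega)]
  obtain ⟨s, hs, h⟩ := exists_shift_of_not_clean hd hT hW hz
  exact ⟨s, by omega, h⟩

end Thinkers

namespace Thinkers

/-! ### Instances that encode hyperedges, and the thinkers of a seed -/

/-- Every bit is preceded by `T` zeros. -/
def spread (T : ℕ) (u : List Bool) : List Bool := u.flatMap fun b => List.replicate T false ++ [b]

/-- The places `p < N` with `v ≤ p`. -/
def levelBits (N v : ℕ) : List Bool := (List.range N).map fun p => decide (v ≤ p)

/-- The instance of a sequence of vertices below `N`. -/
def encodeVertices (T N : ℕ) (vs : List ℕ) : List Bool :=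
  spread T (vs.flatMap (levelBits N) ++ [true, false])

/-- The vertices of a hyperedge. -/
def vertices {K N : ℕ} (e : Fin K ↪ Fin N) : List ℕ := List.ofFn fun k => (e k : ℕ)

/-- The instance of a hyperedge. -/
def encodeEdge {K N : ℕ} (e : Fin K ↪ Fin N) : List Bool := encodeVertices (2 ^ K) N (vertices e)

/-- The window size of the thinkers. -/
def window (K N : ℕ) : ℕ := ((K + 1) * N + 2) * (2 ^ K + 1)

lemma reverse_spread (T : ℕ) (u : List Bool) :
    (spread T u).reverse = u.reverse.flatMap fun b => b :: List.replicate T false := by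
  simp [spread, List.reverse_flatMap, Function.comp_def]

lemma length_spread (T : ℕ) (u : List Bool) : (spread T u).length = u.length * (T + 1) := by
  induction u with
  | nil => simp [spread]
  | cons b u ih =>
    rw [spread, List.flatMap_cons, List.length_append, ← spread, ih]
    simp; ring

lemma getD_flatMap_const {α β : Type} (B : ℕ) (g : α → List β) (hg : ∀ a, (g a).length = B) (b : β)
    (a : α) : ∀ (l : List α) (q c : ℕ), q < l.length → c < B →
      (l.flatMap g).getD (q * B + c) b = (g (l.getD q a)).getD c b
  | [], q, c, hq, _ => by simp at hq
  | x :: l, 0, c, _, hc => by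
    rw [List.flatMap_cons, zero_mul, zero_add, List.getD_append _ _ _ _ (by rw [hg]; exact hc)]
    simp
  | x :: l, q + 1, c, hq, hc => by
    rw [List.flatMap_cons, List.getD_append_right _ _ _ _ (by rw [hg, add_mul]; omega), hg,
      show (q + 1) * B + c - B = q * B + c by rw [add_mul]; omega,
      getD_flatMap_const B g hg b a l q c (by simpa using hq) hc]
    simp

lemma getD_reverse_spread (T : ℕ) (u : List Bool) (q c : ℕ) (hq : q < u.length) (hc : c < T + 1) :
    (spread T u).reverse.getD (q * (T + 1) + c) false =
      if c = 0 then u.reverse.getD q false else false := by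
  rw [reverse_spread, getD_flatMap_const (T + 1) _ (by simp) false false _ _ _ (by simpa) hc]
  rcases c with _ | c
  · simp
  · simp [List.getD, List.getElem?_replicate]
    split_ifs <;> rfl

/-- Spreading puts bits only at the first place of a block. A last bit `false` empties the first
block, whose weights are all `d`. -/
lemma clean_spread (T : ℕ) (u : List Bool) (hu : u.reverse.getD 0 false = false) :
    Clean T u.length (spread T u) := by
  intro i hi hb
  have hq : i / (T + 1) < u.length := Nat.div_lt_of_lt_mul (by rwa [mul_comm])
  have hc := Nat.mod_lt i (Nat.succ_pos T)
  have h := getD_reverse_spread T u (i / (T + 1)) (i % (T + 1)) hq hc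
  rw [Nat.div_add_mod' i (T + 1), hb] at h
  split_ifs at h with h0
  refine ⟨?_, h0⟩
  by_contra hlt
  rw [Nat.div_eq_of_lt (by omega), hu] at h
  exact absurd h (by simp)

/-- The reflection of the index is there because blocks are counted from the end and `u` from the
left. -/
lemma blockForm_spread (T : ℕ) (c : ℕ → ℝ) (u : List Bool) (hu : u.reverse.getD 0 false = false) :
    blockForm T u.length (fun q => c (u.length - 1 - q)) (spread T u) =
      ∑ q ∈ Finset.range u.length, c q * ((u.getD q false).toNat : ℝ) := by
  rw [← Finset.sum_range_reflect]
  refine Finset.sum_congr rfl fun q hq => ?_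
  rw [Finset.mem_range] at hq
  have h := getD_reverse_spread T u q 0 hq (Nat.succ_pos T)
  rw [add_zero, if_pos rfl] at h
  have h2 : u.reverse.getD q false = u.getD (u.length - 1 - q) false := by
    simp only [List.getD]
    rw [List.getElem?_reverse hq]
  rw [bit, h, ← h2]
  split_ifs with h0
  · rw [h0, hu]; simp
  · rfl

lemma sum_range_mul_divMod (K N : ℕ) (f : ℕ → ℕ → ℝ) :
    ∑ q ∈ Finset.range (K * N), f (q / N) (q % N) =
      ∑ k ∈ Finset.range K, ∑ p ∈ Finset.range N, f k p := by
  induction K with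
  | zero => simp
  | succ K ih =>
    rw [add_mul, one_mul, Finset.sum_range_add, ih, Finset.sum_range_succ]
    congr 1
    refine Finset.sum_congr rfl fun p hp => ?_
    rw [Finset.mem_range] at hp
    rw [mul_comm K N, Nat.mul_add_div (by omega), Nat.mul_add_mod, Nat.div_eq_of_lt hp,
      Nat.mod_eq_of_lt hp, add_zero]

/-- Up to the constant `c N`, any function of a vertex is a linear form in its level bits. -/
lemma sum_telescope_levelBits (c : ℕ → ℝ) (v N : ℕ) (h : v ≤ N) :
    ∑ p ∈ Finset.range N, (c p - c (p + 1)) * (((decide (v ≤ p)).toNat : ℕ) : ℝ) = c v - c N := by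
  induction N, h using Nat.le_induction with
  | base =>
    rw [sub_self]
    refine Finset.sum_eq_zero fun p hp => ?_
    rw [Finset.mem_range] at hp
    simp [hp]
  | succ N hN ih =>
    rw [Finset.sum_range_succ, ih]
    simp [hN]

variable {K N : ℕ}

/-- The contribution of the `k`-th vertex `v` to the test of the assignment `a`. -/
noncomputable def penalty (P : (Fin K → Bool) → Bool) (x : Fin N → Bool) (a : Fin K → Bool)
    (k v : ℕ) : ℝ :=
  if h : k < K ∧ v < N then (if P a = true ∧ x ⟨v, h.2⟩ ≠ a ⟨k, h.1⟩ then -1 else 0) else 0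

/-- The weights that test whether the seed takes the values `a`, with `P a`, at the vertices. -/
noncomputable def assignmentWeights (P : (Fin K → Bool) → Bool) (x : Fin N → Bool)
    (a : Fin K → Bool) (q : ℕ) : ℝ :=
  if q < K * N then penalty P x a (q / N) (q % N) - penalty P x a (q / N) (q % N + 1)
  else if q = K * N then (if P a = true then 0 else -1) else 0

lemma penalty_bounds (P : (Fin K → Bool) → Bool) (x : Fin N → Bool) (a : Fin K → Bool)
    (k v : ℕ) : -1 ≤ penalty P x a k v ∧ penalty P x a k v ≤ 0 := by
  unfold penalty
  split_ifs <;> norm_num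

lemma assignmentWeights_ge (P : (Fin K → Bool) → Bool) (x : Fin N → Bool) (a : Fin K → Bool)
    (q : ℕ) : -1 ≤ assignmentWeights P x a q := by
  unfold assignmentWeights
  split_ifs
  · linarith [(penalty_bounds P x a (q / N) (q % N)).1,
      (penalty_bounds P x a (q / N) (q % N + 1)).2]
  all_goals norm_num

lemma length_flatMap_levelBits (N : ℕ) (vs : List ℕ) :
    (vs.flatMap (levelBits N)).length = vs.length * N := by
  induction vs with
  | nil => simp
  | cons v vs ih => simp [ih, levelBits]; ring

lemma length_encodeVertices (T N : ℕ) (vs : List ℕ) :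
    (encodeVertices T N vs).length = (vs.length * N + 2) * (T + 1) := by
  rw [encodeVertices, length_spread, List.length_append, length_flatMap_levelBits]
  rfl

lemma length_encodeEdge_le (e : Fin K ↪ Fin N) : (encodeEdge e).length ≤ window K N := by
  rw [encodeEdge, length_encodeVertices, vertices, List.length_ofFn, window]
  refine Nat.mul_le_mul_right _ ?_
  rw [add_mul]
  omega

/-- This is the purpose of the final `false` in `encodeVertices`. -/
lemma clean_encodeEdge (e : Fin K ↪ Fin N) : Clean (2 ^ K) (K * N + 2) (encodeEdge e) := by
  have h := clean_spread (2 ^ K) ((vertices e).flatMap (levelBits N) ++ [true, false]) (by simp)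
  rw [List.length_append, length_flatMap_levelBits, vertices, List.length_ofFn] at h
  exact h

/-- The level bits of each vertex telescope to its penalty, as the penalty at `N` is zero. The bit
`true` behind them is a constant input and carries the bias, which excludes assignments violating
`P`. -/
lemma blockForm_encodeEdge (P : (Fin K → Bool) → Bool) (x : Fin N → Bool) (a : Fin K → Bool)
    (e : Fin K ↪ Fin N) :
    blockForm (2 ^ K) (K * N + 2) (fun q => assignmentWeights P x a (K * N + 1 - q)) (encodeEdge e)
      = (∑ k : Fin K, penalty P x a k (e k)) + (if P a = true then 0 else -1) := by
  have hlen : ((vertices e).flatMap (levelBits N)).length = K * N := by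
    rw [length_flatMap_levelBits, vertices, List.length_ofFn]
  have hlen2 : ((vertices e).flatMap (levelBits N) ++ [true, false]).length = K * N + 2 := by
    rw [List.length_append, hlen]; rfl
  have h := blockForm_spread (2 ^ K) (assignmentWeights P x a)
    ((vertices e).flatMap (levelBits N) ++ [true, false]) (by simp)
  rw [hlen2] at h
  change blockForm (2 ^ K) (K * N + 2)
    (fun q => assignmentWeights P x a (K * N + 2 - 1 - q)) _ = _
  rw [encodeEdge, encodeVertices, h, Finset.sum_range_succ, Finset.sum_range_succ]
  have h1 : ∀ q ∈ Finset.range (K * N), assignmentWeights P x a q *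
      (((((vertices e).flatMap (levelBits N) ++ [true, false]).getD q false).toNat : ℕ) : ℝ) =
      (fun k p => (penalty P x a k p - penalty P x a k (p + 1)) *
        (((decide ((vertices e).getD k 0 ≤ p)).toNat : ℕ) : ℝ)) (q / N) (q % N) := by
    intro q hq
    rw [Finset.mem_range] at hq
    have hN : 0 < N := by
      rcases Nat.eq_zero_or_pos N with rfl | h
      · simp at hq
      · exact h
    have hk : q / N < K := Nat.div_lt_of_lt_mul (by rwa [mul_comm])
    have hp := Nat.mod_lt q hN
    have h2 := getD_flatMap_const N (levelBits N) (by simp [levelBits]) false 0 (vertices e)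
      (q / N) (q % N) (by simpa [vertices] using hk) hp
    rw [Nat.div_add_mod' q N] at h2
    rw [List.getD_append _ _ _ _ (by rw [hlen]; exact hq), h2, assignmentWeights, if_pos hq]
    simp [levelBits, hp]
  rw [Finset.sum_congr rfl h1, sum_range_mul_divMod K N (fun k p =>
    (penalty P x a k p - penalty P x a k (p + 1)) *
        (((decide ((vertices e).getD k 0 ≤ p)).toNat : ℕ) : ℝ))]
  have h3 : ∀ k : Fin K, ∑ p ∈ Finset.range N,
      (penalty P x a k p - penalty P x a k (p + 1)) *
        (((decide ((vertices e).getD k 0 ≤ p)).toNat : ℕ) : ℝ) = penalty P x a k (e k) := by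
    intro k
    have hv : (vertices e).getD k 0 = e k := by simp [vertices]
    rw [hv, sum_telescope_levelBits (fun p => penalty P x a k p) _ _ (e k).2.le]
    simp [penalty]
  rw [Finset.sum_range, Finset.sum_congr rfl fun k _ => h3 k]
  rw [List.getD_append_right _ _ _ _ (by rw [hlen]), List.getD_append_right _ _ _ _
    (by rw [hlen]; omega), hlen]
  simp [assignmentWeights]

/-- No summand is positive, so the form is non-negative only if every penalty and the bias vanish.
-/
lemma blockForm_encodeEdge_nonneg (P : (Fin K → Bool) → Bool) (x : Fin N → Bool)
    (a : Fin K → Bool) (e : Fin K ↪ Fin N) :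
    0 ≤ blockForm (2 ^ K) (K * N + 2) (fun q => assignmentWeights P x a (K * N + 1 - q))
      (encodeEdge e) ↔ P a = true ∧ a = fun k => x (e k) := by
  rw [blockForm_encodeEdge]
  have hle : ∀ k ∈ (Finset.univ : Finset (Fin K)), penalty P x a k (e k) ≤ 0 :=
    fun k _ => (penalty_bounds P x a k (e k)).2
  have hs : ∑ k : Fin K, penalty P x a k (e k) ≤ 0 := Finset.sum_nonpos hle
  by_cases hP : P a = true
  · rw [if_pos hP, add_zero]
    have : 0 ≤ ∑ k : Fin K, penalty P x a k (e k) ↔ ∑ k : Fin K, penalty P x a k (e k) = 0 :=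
      ⟨fun h => le_antisymm hs h, fun h => h.ge⟩
    rw [this, Finset.sum_eq_zero_iff_of_nonpos hle]
    simp only [hP, true_and, funext_iff]
    refine forall_congr' fun k => ?_
    simp [penalty, hP, eq_comm]
  · rw [if_neg hP]
    simp only [hP]
    constructor
    · intro h; linarith
    · simp

/-- The assignments in an order. -/
noncomputable def assignmentEquiv (K : ℕ) : (Fin K → Bool) ≃ Fin (2 ^ K) :=
  Fintype.equivFinOfCardEq (by simp)

/-- The assignment that the `j`-th thinker tests in step `s`. -/
noncomputable def assignmentAt (j : Fin (2 ^ K)) (s : ℕ) : Fin K → Bool :=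
  (assignmentEquiv K).symm (j + Fin.ofNat (2 ^ K) s)

/-- The thinkers of a seed. They differ in the order in which they test the assignments. -/
noncomputable def seedThinker (P : (Fin K → Bool) → Bool) (x : Fin N → Bool) (j : Fin (2 ^ K)) :
    Thinker :=
  revThinker (window K N) (blockWeights (window K N) (2 ^ K) (K * N + 2)
    fun s q => assignmentWeights P x (assignmentAt j s) (K * N + 1 - q))

/-- The chain of thought `0…01…1` with `τ` zeros, or `0…0` if `y` is `false`. -/
def stepCot (K : ℕ) (y : Bool) (τ : Fin (2 ^ K)) : List Bool :=
  (List.range (2 ^ K)).map fun t => y && decide ((τ : ℕ) ≤ t)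

variable (P : (Fin K → Bool) → Bool) (x : Fin N → Bool)

lemma seedThinker_mem (j : Fin (2 ^ K)) : seedThinker P x j ∈ linClass (window K N) :=
  revThinker_mem _ _

lemma window_ge : (K * N + 2) * (2 ^ K + 1) ≤ window K N := by
  unfold window
  refine Nat.mul_le_mul_right _ ?_
  rw [add_mul]; omega

lemma e2e_seedThinker_of_clean (j : Fin (2 ^ K)) {z : List Bool}
    (hz : Clean (2 ^ K) (K * N + 2) z) {t : ℕ} (ht : t < 2 ^ K) :
    e2e (seedThinker P x j) (t + 1) z = true ↔ ∃ s ≤ t, 0 ≤ blockForm (2 ^ K) (K * N + 2)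
      (fun q => assignmentWeights P x (assignmentAt j s) (K * N + 1 - q)) z :=
  e2e_blockWeights_of_clean window_ge (by omega) (fun _ _ => assignmentWeights_ge _ _ _ _) hz ht

/-- In the cyclic order starting at `j`, each assignment is tested exactly once in `2 ^ K` steps. -/
lemma assignmentAt_eq_iff (j : Fin (2 ^ K)) {s : ℕ} (hs : s < 2 ^ K) (a : Fin K → Bool) :
    assignmentAt j s = a ↔ ((assignmentEquiv K a - j : Fin (2 ^ K)) : ℕ) = s := by
  rw [assignmentAt, Equiv.symm_apply_eq, ← eq_sub_iff_add_eq', Fin.ext_iff, eq_comm]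
  simp [Fin.ofNat, Nat.mod_eq_of_lt hs]

/-- After `2 ^ K` steps every thinker has tested every assignment, and a disjunction does not depend
on the order. On strings that are not clean both sides are `true`. -/
lemma e2e_seedThinker_eq (i j : Fin (2 ^ K)) :
    e2e (seedThinker P x i) (2 ^ K) = e2e (seedThinker P x j) (2 ^ K) := by
  have hT : 0 < 2 ^ K := by positivity
  funext z
  by_cases hz : Clean (2 ^ K) (K * N + 2) z
  · have key : ∀ j : Fin (2 ^ K), e2e (seedThinker P x j) (2 ^ K) z = true ↔
        ∃ a, 0 ≤ blockForm (2 ^ K) (K * N + 2)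
          (fun q => assignmentWeights P x a (K * N + 1 - q)) z := by
      intro j
      have h := e2e_seedThinker_of_clean P x j hz (t := 2 ^ K - 1) (by omega)
      rw [Nat.sub_add_cancel hT] at h
      rw [h]
      constructor
      · rintro ⟨s, _, h⟩
        exact ⟨_, h⟩
      · rintro ⟨a, h⟩
        refine ⟨(assignmentEquiv K a - j : Fin (2 ^ K)), by omega, ?_⟩
        rwa [(assignmentAt_eq_iff j (Fin.is_lt _) a).2 rfl]
    rw [Bool.eq_iff_iff, key, key]
  · rw [seedThinker, seedThinker,
      e2e_blockWeights_of_not_clean window_ge (by omega) hT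
        (fun _ _ => assignmentWeights_ge _ _ _ _) hz,
      e2e_blockWeights_of_not_clean window_ge (by omega) hT
        (fun _ _ => assignmentWeights_ge _ _ _ _) hz]

lemma e2e_seedThinker_encodeEdge (j : Fin (2 ^ K)) (e : Fin K ↪ Fin N) {t : ℕ} (ht : t < 2 ^ K) :
    e2e (seedThinker P x j) (t + 1) (encodeEdge e) = ((P fun k => x (e k)) &&
      decide (((assignmentEquiv K (fun k => x (e k)) - j : Fin (2 ^ K)) : ℕ) ≤ t)) := by
  rw [Bool.eq_iff_iff, e2e_seedThinker_of_clean P x j (clean_encodeEdge e) ht]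
  simp only [blockForm_encodeEdge_nonneg, Bool.and_eq_true, decide_eq_true_iff]
  constructor
  · rintro ⟨s, hs, hP, ha⟩
    rw [assignmentAt_eq_iff j (by omega)] at ha
    rw [ha]
    refine ⟨?_, hs⟩
    rwa [(assignmentAt_eq_iff j (by omega) _).2 ha] at hP
  · rintro ⟨hP, hle⟩
    have h := (assignmentAt_eq_iff j (Fin.is_lt _) fun k => x (e k)).2 rfl
    exact ⟨_, hle, by rwa [h], h⟩

/-- Only the assignment read off the seed can pass its test. Seed and identity therefore show only
through the label and the delay until that test. -/
lemma cot_seedThinker_encodeEdge (j : Fin (2 ^ K)) (e : Fin K ↪ Fin N) :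
    cot (seedThinker P x j) (2 ^ K) (encodeEdge e) =
      stepCot K (P fun k => x (e k)) (assignmentEquiv K (fun k => x (e k)) - j) := by
  unfold cot stepCot
  refine List.map_congr_left fun t ht => ?_
  rw [List.mem_range] at ht
  exact e2e_seedThinker_encodeEdge P x j e ht

lemma e2e_seedThinker_last (j : Fin (2 ^ K)) (e : Fin K ↪ Fin N) :
    e2e (seedThinker P x j) (2 ^ K) (encodeEdge e) = P fun k => x (e k) := by
  have hT : 0 < 2 ^ K := by positivity
  have h := e2e_seedThinker_encodeEdge P x j e (t := 2 ^ K - 1) (by omega)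
  rw [Nat.sub_add_cancel hT] at h
  rw [h, decide_eq_true (by omega), Bool.and_true]

end Thinkers

/-! ### The distinguisher as a polynomial-time stack program -/

namespace Thinkers

open Function

/-! ### Running programs -/

/-- In at most `B` steps the program `p` turns the memory `m` into `m'` and terminates. -/
def Runs (p : Prog) (m m' : Memory) (B : ℕ) : Prop :=
  ∃ t ≤ B, ∀ k, step^[t] (p :: k, m) = (k, m')

namespace Runs

variable {p q r : Prog} {m m' m'' : Memory} {B C : ℕ} {i : ℕ}

lemma mono (h : Runs p m m' B) (hB : B ≤ C) : Runs p m m' C :=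
  let ⟨t, ht, hk⟩ := h
  ⟨t, ht.trans hB, hk⟩

lemma congr (h : Runs p m m' B) (hm : m' = m'') (hB : B ≤ C) : Runs p m m'' C := hm ▸ h.mono hB

lemma skip (m : Memory) : Runs .skip m m 1 := ⟨1, le_rfl, fun _ => rfl⟩

lemma push (i : ℕ) (b : Bool) (m : Memory) : Runs (.push i b) m (update m i (b :: m i)) 1 :=
  ⟨1, le_rfl, fun _ => rfl⟩

lemma pop (i : ℕ) (m : Memory) : Runs (.pop i) m (update m i (m i).tail) 1 :=
  ⟨1, le_rfl, fun _ => rfl⟩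

lemma seq (hp : Runs p m m' B) (hq : Runs q m' m'' C) : Runs (.seq p q) m m'' (B + C + 1) := by
  obtain ⟨t, ht, hk⟩ := hp
  obtain ⟨u, hu, hl⟩ := hq
  refine ⟨u + (t + 1), by omega, fun k => ?_⟩
  rw [iterate_add_apply, iterate_succ_apply]
  change step^[u] (step^[t] (p :: q :: k, m)) = _
  rw [hk, hl]

lemma branch_nil (hi : m i = []) (h : Runs p m m' B) : Runs (.branch i p q r) m m' (B + 1) := by
  obtain ⟨t, ht, hk⟩ := h
  refine ⟨t + 1, by omega, fun k => ?_⟩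
  rw [iterate_succ_apply]
  have : step (.branch i p q r :: k, m) = (p :: k, m) := by simp [step, hi]
  rw [this, hk]

lemma branch_cons {b : Bool} {l : List Bool} (hi : m i = b :: l)
    (h : Runs (if b then r else q) m m' B) : Runs (.branch i p q r) m m' (B + 1) := by
  obtain ⟨t, ht, hk⟩ := h
  refine ⟨t + 1, by omega, fun k => ?_⟩
  rw [iterate_succ_apply]
  have : step (.branch i p q r :: k, m) = ((if b then r else q) :: k, m) := by
    cases b <;> simp [step, hi]
  rw [this, hk]

lemma loop_nil (hi : m i = []) : Runs (.loop i p) m m 1 :=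
  ⟨1, le_rfl, fun k => by simp [step, hi]⟩

lemma loop_cons (hi : m i ≠ []) (hp : Runs p m m' B) (hl : Runs (.loop i p) m' m'' C) :
    Runs (.loop i p) m m'' (B + C + 1) := by
  obtain ⟨t, ht, hk⟩ := hp
  obtain ⟨u, hu, hl⟩ := hl
  refine ⟨u + (t + 1), by omega, fun k => ?_⟩
  rw [iterate_add_apply, iterate_succ_apply]
  have : step (.loop i p :: k, m) = (p :: .loop i p :: k, m) := by
    obtain ⟨b, l, h⟩ := List.exists_cons_of_ne_nil hi
    simp [step, h]
  rw [this, hk, hl]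

/-- A loop that runs through the memories `s 0, …, s n`. -/
lemma loop (s : ℕ → Memory) (n : ℕ) (hs : ∀ k < n, s k i ≠ [] ∧ Runs p (s k) (s (k + 1)) B)
    (hn : s n i = []) : Runs (.loop i p) (s 0) (s n) (n * (B + 1) + 1) := by
  induction n generalizing s with
  | zero => exact (loop_nil hn).mono (by omega)
  | succ n ih =>
    have h := ih (fun k => s (k + 1)) (fun k hk => hs (k + 1) (by omega)) hn
    exact (loop_cons (hs 0 (by omega)).1 (hs 0 (by omega)).2 h).mono (by rw [add_mul]; omega)

end Runs

lemma step_halted (t : ℕ) (m : Memory) : step^[t] (([], m) : Config) = ([], m) := by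
  induction t with
  | zero => rfl
  | succ t ih => rw [iterate_succ_apply]; exact ih

lemma step_append {ks : List Prog} (hks : ks ≠ []) (k : List Prog) (m : Memory) :
    step (ks ++ k, m) = ((step (ks, m)).1 ++ k, (step (ks, m)).2) := by
  obtain ⟨p, l, rfl⟩ := List.exists_cons_of_ne_nil hks
  cases p with
  | skip => rfl
  | push => rfl
  | pop => rfl
  | seq => rfl
  | branch i p q r =>
    rcases h : m i with _ | ⟨_ | _, _⟩ <;> simp [step, h]
  | loop i p =>
    rcases h : m i with _ | ⟨_, _⟩ <;> simp [step, h]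

/-- A step only inspects the head of the program list, so a halting computation can be followed by
any continuation; `u` drops the idle steps after halting. -/
lemma runs_of_halts (t : ℕ) : ∀ (ks : List Prog) (m : Memory), (step^[t] (ks, m)).1 = [] →
    ∃ u ≤ t, ∀ k, step^[u] (ks ++ k, m) = (k, (step^[t] (ks, m)).2) := by
  induction t with
  | zero =>
    intro ks m h
    have h' : ks = [] := h
    subst h'
    exact ⟨0, le_rfl, fun k => rfl⟩
  | succ t ih =>
    intro ks m h
    rcases eq_or_ne ks [] with rfl | hks
    · exact ⟨0, by omega, fun k => by rw [step_halted]; rfl⟩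
    · rw [iterate_succ_apply] at h
      obtain ⟨u, hu, hk⟩ := ih (step (ks, m)).1 (step (ks, m)).2 h
      refine ⟨u + 1, by omega, fun k => ?_⟩
      rw [iterate_succ_apply, step_append hks, hk, iterate_succ_apply]

lemma Runs.haltsIn {p : Prog} {input : List (List Bool)} {m' : Memory} {B t : ℕ}
    (h : Runs p (fun i => input.getD i []) m' B) (ht : B ≤ t) :
    p.HaltsIn input t ∧ p.output input t = m' 0 := by
  obtain ⟨u, hu, hk⟩ := h
  have : p.run input t = ([], m') := by
    rw [Prog.run, show t = (t - u) + u by omega, iterate_add_apply, hk, step_halted]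
  rw [Prog.HaltsIn, Prog.output, this]
  exact ⟨rfl, rfl⟩

lemma length_step_le (c : Config) (i : ℕ) : ((step c).2 i).length ≤ (c.2 i).length + 1 := by
  obtain ⟨ks, m⟩ := c
  rcases ks with _ | ⟨p, k⟩
  · simp [step]
  cases p with
  | skip => simp [step]
  | push j b => 
    by_cases h : i = j
    · subst h; simp [step]
    · simp [step, h]
  | pop j =>
    by_cases h : i = j
    · subst h; simp [step]; omega
    · simp [step, h]
  | seq => simp [step]
  | branch j p q r =>
    rcases h : m j with _ | ⟨_ | _, _⟩ <;> simp [step, h]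
  | loop j p =>
    rcases h : m j with _ | ⟨_, _⟩ <;> simp [step, h]

/-- A step pushes at most one bit. This bounds the learned representation, hence the cost of copying
it for each test. -/
lemma length_output_le (p : Prog) (input : List (List Bool)) (t : ℕ) :
    (p.output input t).length ≤ (input.getD 0 []).length + t := by
  rw [Prog.output, Prog.run]
  induction t with
  | zero => simp
  | succ t ih =>
    rw [iterate_succ_apply']
    exact (length_step_le _ _).trans (by omega)

/-! ### Renaming the stacks of a program -/

/-- The program with stack `i` renamed to `e i`. -/
def Prog.rename (e : ℕ → ℕ) : Prog → Prog
  | .skip => .skip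
  | .push i b => .push (e i) b
  | .pop i => .pop (e i)
  | .seq p q => .seq (p.rename e) (q.rename e)
  | .branch i p q r => .branch (e i) (p.rename e) (q.rename e) (r.rename e)
  | .loop i p => .loop (e i) (p.rename e)

lemma update_comp_injective {e : ℕ → ℕ} (he : Injective e) (m : Memory) (i : ℕ) (l : List Bool) :
    (fun j => update m (e i) l (e j)) = update (fun j => m (e j)) i l := by
  funext j
  by_cases h : j = i
  · subst h; simp
  · simp [h, he.ne h]

lemma step_rename {e : ℕ → ℕ} (he : Injective e) (ks : List Prog) (m : Memory) :
    ∃ m', step (ks.map (Prog.rename e), m) =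
        ((step (ks, fun i => m (e i))).1.map (Prog.rename e), m') ∧
      (fun i => m' (e i)) = (step (ks, fun i => m (e i))).2 ∧ ∀ j, j ∉ Set.range e → m' j = m j := by
  rcases ks with _ | ⟨p, k⟩
  · exact ⟨m, rfl, rfl, fun _ _ => rfl⟩
  have hne : ∀ i j, j ∉ Set.range e → j ≠ e i := fun i j hj h => hj ⟨i, h.symm⟩
  cases p with
  | skip => exact ⟨m, rfl, rfl, fun _ _ => rfl⟩
  | push i b =>
    exact ⟨_, rfl, update_comp_injective he _ _ _, fun j hj => update_of_ne (hne i j hj) _ _⟩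
  | pop i =>
    exact ⟨_, rfl, update_comp_injective he _ _ _, fun j hj => update_of_ne (hne i j hj) _ _⟩
  | seq => exact ⟨m, rfl, rfl, fun _ _ => rfl⟩
  | branch i p q r =>
    refine ⟨m, ?_, ?_, fun _ _ => rfl⟩ <;>
    rcases h : m (e i) with _ | ⟨_ | _, _⟩ <;> simp [step, h, Prog.rename]
  | loop i p =>
    refine ⟨m, ?_, ?_, fun _ _ => rfl⟩ <;>
    rcases h : m (e i) with _ | ⟨_, _⟩ <;> simp [step, h, Prog.rename]

lemma iterate_step_rename {e : ℕ → ℕ} (he : Injective e) (t : ℕ) (ks : List Prog) (m : Memory) :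
    ∃ m', step^[t] (ks.map (Prog.rename e), m) =
        ((step^[t] (ks, fun i => m (e i))).1.map (Prog.rename e), m') ∧
      (fun i => m' (e i)) = (step^[t] (ks, fun i => m (e i))).2 ∧
      ∀ j, j ∉ Set.range e → m' j = m j := by
  induction t with
  | zero => exact ⟨m, rfl, rfl, fun _ _ => rfl⟩
  | succ t ih =>
    obtain ⟨m1, h1, h2, h3⟩ := ih
    obtain ⟨m2, h4, h5, h6⟩ := step_rename he (step^[t] (ks, fun i => m (e i))).1 m1
    rw [h2] at h4 h5
    refine ⟨m2, ?_, ?_, fun j hj => (h6 j hj).trans (h3 j hj)⟩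
    · rw [iterate_succ_apply', h1, h4, iterate_succ_apply']
    · rw [h5, iterate_succ_apply']

/-- A subroutine call: `p` works on the private stacks `e 0, e 1, …` and leaves all others
untouched. -/
lemma runs_rename {e : ℕ → ℕ} (he : Injective e) {p : Prog} {input : List (List Bool)} {t : ℕ}
    (hp : p.HaltsIn input t) {m : Memory} (hm : ∀ i, m (e i) = input.getD i []) :
    ∃ m', Runs (p.rename e) m m' t ∧ m' (e 0) = p.output input t ∧
      ∀ j, j ∉ Set.range e → m' j = m j := by
  obtain ⟨m1, h1, h2, h3⟩ := iterate_step_rename he t [p] m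
  have hm' : (fun i => m (e i)) = fun i => input.getD i [] := funext hm
  rw [hm'] at h1 h2
  rw [Prog.HaltsIn, Prog.run] at hp
  rw [hp] at h1
  obtain ⟨u, hu, hk⟩ := runs_of_halts t ([p].map (Prog.rename e)) m (by rw [h1]; rfl)
  rw [h1] at hk
  exact ⟨m1, ⟨u, hu, hk⟩, congrFun h2 0, h3⟩

/-! ### Elementary programs -/

namespace Prog

/-- Move stack `a` to stack `b`, which reverses it. -/
def move (a b : ℕ) : Prog :=
  .loop a (.branch a .skip (.seq (.pop a) (.push b false)) (.seq (.pop a) (.push b true)))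

/-- Move stack `a` to the stacks `b` and `c`, which reverses it. -/
def moveTwo (a b c : ℕ) : Prog :=
  .loop a (.branch a .skip (.seq (.pop a) (.seq (.push b false) (.push c false)))
    (.seq (.pop a) (.seq (.push b true) (.push c true))))

/-- Copy stack `a` to stack `c`, using the empty stack `b`. -/
def copy (a b c : ℕ) : Prog := .seq (move a b) (moveTwo b a c)

/-- Push the entries of a list, in order. -/
def emit (o : ℕ) : List Bool → Prog
  | [] => .skip
  | b :: l => .seq (.push o b) (emit o l)

/-- Empty stack `a`. -/
def clear (a : ℕ) : Prog := .loop a (.pop a)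

/-- Repeat a program. -/
def rep (p : Prog) : ℕ → Prog
  | 0 => .skip
  | n + 1 => .seq p (rep p n)

end Prog

lemma runs_move {a b : ℕ} (hab : a ≠ b) (m : Memory) :
    Runs (.move a b) m (update (update m a []) b ((m a).reverse ++ m b))
      (5 * (m a).length + 1) := by
  generalize hl : m a = l
  induction l generalizing m with
  | nil =>
    refine (Runs.loop_nil hl).congr ?_ (by simp)
    have : update m a [] = m := by rw [← hl, update_eq_self]
    simp [this]
  | cons c l ih =>
    have h1 : Runs (.branch a .skip (.seq (.pop a) (.push b false))
        (.seq (.pop a) (.push b true))) m (update (update m a l) b (c :: m b)) 4 := by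
      refine Runs.branch_cons hl (B := 3) ?_
      have := (Runs.pop a m).seq (Runs.push b c _)
      rw [hl] at this
      cases c <;> simpa [hab.symm] using this
    have h2 := ih (update (update m a l) b (c :: m b)) (by simp [hab])
    refine (Runs.loop_cons (by simp [hl]) h1 h2).congr ?_ (by simp; omega)
    funext j
    by_cases hj : j = b
    · subst hj; simp
    · by_cases hj' : j = a
      · subst hj'; simp [hab]
      · simp [hj, hj']

lemma runs_moveTwo {a b c : ℕ} (hab : a ≠ b) (hac : a ≠ c) (hbc : b ≠ c) (m : Memory) :
    Runs (.moveTwo a b c) m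
      (update (update (update m a []) b ((m a).reverse ++ m b)) c ((m a).reverse ++ m c))
      (7 * (m a).length + 1) := by
  generalize hl : m a = l
  induction l generalizing m with
  | nil =>
    refine (Runs.loop_nil hl).congr ?_ (by simp)
    have : update m a [] = m := by rw [← hl, update_eq_self]
    simp [this]
  | cons x l ih =>
    have h1 : Runs (.branch a .skip (.seq (.pop a) (.seq (.push b false) (.push c false)))
        (.seq (.pop a) (.seq (.push b true) (.push c true)))) m
        (update (update (update m a l) b (x :: m b)) c (x :: m c)) 6 := by
      refine Runs.branch_cons hl (B := 5) ?_
      have := (Runs.pop a m).seq ((Runs.push b x _).seq (Runs.push c x _))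
      rw [hl] at this
      cases x <;> simpa [hab.symm, hac.symm, hbc.symm] using this
    have h2 := ih (update (update (update m a l) b (x :: m b)) c (x :: m c)) (by simp [hab, hac])
    refine (Runs.loop_cons (by simp [hl]) h1 h2).congr ?_ (by simp; omega)
    funext j
    by_cases hj : j = c
    · subst hj; simp
    · by_cases hj' : j = b
      · subst hj'; simp [hj]
      · by_cases hj'' : j = a
        · subst hj''; simp [hab, hac]
        · simp [hj, hj', hj'']

lemma runs_copy {a b c : ℕ} (hab : a ≠ b) (hac : a ≠ c) (hbc : b ≠ c) {m : Memory}
    (hb : m b = []) :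
    Runs (.copy a b c) m (update m c (m a ++ m c)) (12 * (m a).length + 3) := by
  refine ((runs_move hab m).seq (runs_moveTwo hab.symm hbc hac _)).congr ?_ ?_
  · funext j
    by_cases hj : j = c
    · subst hj; simp [hb, hbc.symm, hac.symm]
    · by_cases hj' : j = b
      · subst hj'; simp [hj, hb, hab.symm]
      · by_cases hj'' : j = a
        · subst hj''; simp [hab, hac, hb]
        · simp [hj, hj', hj'']
  · simp [hb]; omega

lemma runs_emit (o : ℕ) (l : List Bool) (m : Memory) :
    Runs (.emit o l) m (update m o (l.reverse ++ m o)) (2 * l.length + 1) := by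
  induction l generalizing m with
  | nil => exact (Runs.skip m).congr (by simp) (by simp)
  | cons b l ih =>
    exact ((Runs.push o b m).seq (ih _)).congr (by simp) (by simp; omega)

lemma runs_clear (a : ℕ) (m : Memory) :
    Runs (.clear a) m (update m a []) (2 * (m a).length + 1) := by
  generalize hl : m a = l
  induction l generalizing m with
  | nil => exact (Runs.loop_nil hl).congr (by rw [← hl]; simp) (by simp)
  | cons b l ih =>
    refine (Runs.loop_cons (by simp [hl]) (Runs.pop a m) (ih _ (by simp [hl]))).congr
      (by simp) (by simp; omega)

lemma runs_rep_pop (a n : ℕ) (m : Memory) :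
    Runs (.rep (.pop a) n) m (update m a ((m a).drop n)) (2 * n + 1) := by
  induction n generalizing m with
  | zero => exact (Runs.skip m).congr (by simp) (by simp)
  | succ n ih => exact ((Runs.pop a m).seq (ih _)).congr (by simp) (by omega)

/-! ### Polynomially bounded functions -/

/-- A function bounded by a polynomial. -/
def PolyBdd (f : ℕ → ℕ) : Prop := ∃ p : Polynomial ℕ, ∀ n, f n ≤ p.eval n

namespace PolyBdd

lemma const (c : ℕ) : PolyBdd fun _ => c := ⟨Polynomial.C c, fun n => by simp⟩

lemma id : PolyBdd fun n => n := ⟨Polynomial.X, fun n => by simp⟩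

lemma add {f g : ℕ → ℕ} : PolyBdd f → PolyBdd g → PolyBdd fun n => f n + g n
  | ⟨p, hp⟩, ⟨q, hq⟩ => ⟨p + q, fun n => by simpa using add_le_add (hp n) (hq n)⟩

lemma mul {f g : ℕ → ℕ} : PolyBdd f → PolyBdd g → PolyBdd fun n => f n * g n
  | ⟨p, hp⟩, ⟨q, hq⟩ => ⟨p * q, fun n => by simpa using Nat.mul_le_mul (hp n) (hq n)⟩

lemma eval (p : Polynomial ℕ) : PolyBdd fun n => p.eval n := ⟨p, fun _ => le_rfl⟩

end PolyBdd

/-! ### Polynomials in unary -/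

lemma unary_succ (n : ℕ) : unary (n + 1) = true :: unary n := rfl

lemma unary_add (a b : ℕ) : unary (a + b) = unary a ++ unary b := by
  simp [unary, List.replicate_append_replicate]

lemma length_unary (n : ℕ) : (unary n).length = n := by simp [unary]

lemma reverse_unary (n : ℕ) : (unary n).reverse = unary n := by simp [unary]

namespace Prog

/-- Multiply the length of the stack `o` of ones by that of `a`, using the empty stacks `b`
and `c`. -/
def mulUnary (a b c o : ℕ) : Prog := .seq (move o c) (.loop c (.seq (.pop c) (copy a b o)))

end Prog

lemma runs_mulUnary {a b c o : ℕ} (hab : a ≠ b) (hac : a ≠ c) (hao : a ≠ o) (hbc : b ≠ c)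
    (hbo : b ≠ o) (hco : c ≠ o) {N n : ℕ} {m : Memory} (ha : m a = unary N) (hb : m b = [])
    (hc : m c = []) (ho : m o = unary n) :
    Runs (.mulUnary a b c o) m (update m o (unary (n * N))) (n * (12 * N + 11) + 3) := by
  have h1 := runs_move hco.symm m
  rw [ho, hc, reverse_unary, List.append_nil, length_unary] at h1
  let s : ℕ → Memory := fun k => update (update m o (unary (k * N))) c (unary (n - k))
  have h2 : Runs (.loop c (.seq (.pop c) (.copy a b o))) (s 0) (s n)
      (n * ((1 + (12 * N + 3) + 1) + 1) + 1) := by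
    refine Runs.loop s n (fun k hk => ⟨?_, ?_⟩) ?_
    · obtain ⟨r, hr⟩ : ∃ r, n - k = r + 1 := ⟨n - k - 1, by omega⟩
      simp [s, hr, unary_succ]
    · refine ((Runs.pop c _).seq (runs_copy hab hao hbo ?_)).congr ?_ ?_
      · simp [s, hbc, hbo, hb]
      · obtain ⟨r, hr⟩ : ∃ r, n - k = r + 1 := ⟨n - k - 1, by omega⟩
        have hr' : n - (k + 1) = r := by omega
        funext j
        by_cases hj : j = o
        · subst hj; simp [s, hco.symm, hac, hao, ha, ← unary_add, add_mul, add_comm]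
        · by_cases hj' : j = c
          · subst hj'; simp [s, hj, hr, hr', unary_succ]
          · simp [s, hj, hj']
      · simp [s, hac, hao, ha, length_unary]
    · simp [s, unary]
  have h0 : update (update m o []) c (unary n) = s 0 := by simp [s, unary]
  rw [h0] at h1
  refine (h1.seq h2).congr ?_ ?_
  · funext j
    by_cases hj : j = c
    · subst hj; simp [s, hc, unary, hco]
    · simp [s, hj]
  · have : n * (1 + (12 * N + 3) + 1 + 1) + 5 * n = n * (12 * N + 11) := by ring
    omega

/-- Horner's scheme in unary. The values serve as loop counters and as the learner's size parameter.
-/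
lemma exists_unaryEval {a b c o : ℕ} (hab : a ≠ b) (hac : a ≠ c) (hao : a ≠ o) (hbc : b ≠ c)
    (hbo : b ≠ o) (hco : c ≠ o) (p : Polynomial ℕ) :
    ∃ (Q : Prog) (τ : ℕ → ℕ), PolyBdd τ ∧ ∀ (N : ℕ) (m : Memory), m a = unary N → m b = [] →
      m c = [] → m o = [] → Runs Q m (update m o (unary (p.eval N))) (τ N) := by
  induction p using Polynomial.recOnHorner with
  | M0 => exact ⟨.skip, fun _ => 1, .const 1, fun N m _ _ _ ho =>
      (Runs.skip m).congr (by simp [unary, ← ho]) le_rfl⟩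
  | MC p k _ _ ih =>
    obtain ⟨Q, τ, hτ, h⟩ := ih
    refine ⟨.seq Q (.emit o (unary k)), fun N => τ N + (2 * k + 1) + 1,
      (hτ.add (.const _)).add (.const 1), fun N m ha hb hc ho => ?_⟩
    refine ((h N m ha hb hc ho).seq (runs_emit o (unary k) _)).congr ?_ ?_
    · simp [reverse_unary, ← unary_add, add_comm]
    · simp [length_unary]
  | MX p _ ih =>
    obtain ⟨Q, τ, hτ, h⟩ := ih
    refine ⟨.seq Q (.mulUnary a b c o), fun N => τ N + (p.eval N * (12 * N + 11) + 3) + 1,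
      (hτ.add (((PolyBdd.eval p).mul (((PolyBdd.const 12).mul .id).add (.const 11))).add
        (.const 3))).add (.const 1), fun N m ha hb hc ho => ?_⟩
    refine ((h N m ha hb hc ho).seq (runs_mulUnary (N := N) (n := p.eval N) hab hac hao hbc hbo hco
      ?_ ?_ ?_ ?_)).congr ?_ le_rfl
    · simp [hao, ha]
    · simp [hbo, hb]
    · simp [hco, hc]
    · simp
    · simp

end Thinkers

namespace Thinkers

open Function

/-! ### Emitting encoded hyperedges -/

/-- The code of a sequence of vertices in the input of a distinguisher. -/
def vertexCode (vs : List ℕ) : List Bool := vs.flatMap fun v => unary v ++ [false]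

lemma levelBits_succ (k v : ℕ) : levelBits (k + 1) v = levelBits k v ++ [decide (v ≤ k)] := by
  simp [levelBits, List.range_succ]

namespace Prog

/-- Read a vertex from stack `1` and push the codes of its level bits on stack `5`; stack `0` holds
the number of vertices in unary. -/
def emitVertex (blk : Bool → List Bool) : Prog :=
  .seq (copy 0 4 6) (.seq
    (.loop 6 (.seq (.pop 6) (.branch 1 .skip (emit 5 (blk true))
      (.seq (.pop 1) (emit 5 (blk false))))))
    (.pop 1))

/-- Read `n` bits from stack `a` and continue with a program that depends on them. -/
def readBits (a : ℕ) : ℕ → (List Bool → Prog) → Prog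
  | 0, leaf => leaf []
  | n + 1, leaf => .branch a .skip
      (.seq (.pop a) (readBits a n fun l => leaf (false :: l)))
      (.seq (.pop a) (readBits a n fun l => leaf (true :: l)))

/-- Read `K` vertices from stack `1` and push their instance on stack `5`, with every bit encoded
by `cc`. -/
def emitEdge (K : ℕ) (cc : Bool → List Bool) : Prog :=
  .seq (rep (emitVertex fun b => (List.replicate (2 ^ K) false ++ [b]).flatMap cc) K)
    (emit 5 ((spread (2 ^ K) [true, false]).flatMap cc))

end Prog

/-- One `true` of the unary vertex is consumed per place; once the terminating `false` is on top it
is left there, so all later places give level bit `true`. It is removed at the end. -/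
lemma runs_emitVertex (blk : Bool → List Bool) {c : ℕ} (hc : ∀ b, (blk b).length ≤ c)
    {N v : ℕ} (hv : v ≤ N) {rest : List Bool} {m : Memory} (h0 : m 0 = unary N) (h4 : m 4 = [])
    (h6 : m 6 = []) (h1 : m 1 = unary v ++ false :: rest) :
    Runs (.emitVertex blk) m
      (update (update m 1 rest) 5 (((levelBits N v).flatMap blk).reverse ++ m 5))
      (12 * N + (N * (2 * c + 7)) + 8) := by
  have hcopy := runs_copy (a := 0) (b := 4) (c := 6) (by decide) (by decide) (by decide) h4
  rw [h0, h6, List.append_nil, length_unary] at hcopy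
  let s : ℕ → Memory := fun k => update (update (update m 6 (unary (N - k))) 1
    (unary (v - k) ++ false :: rest)) 5 (((levelBits k v).flatMap blk).reverse ++ m 5)
  have hloop : Runs (.loop 6 (.seq (.pop 6) (.branch 1 .skip (.emit 5 (blk true))
      (.seq (.pop 1) (.emit 5 (blk false)))))) (s 0) (s N) (N * ((2 * c + 6) + 1) + 1) := by
    refine Runs.loop s N (fun k hk => ?_) (by simp [s, unary])
    obtain ⟨r, hr⟩ : ∃ r, N - k = r + 1 := ⟨N - k - 1, by omega⟩
    have hr' : N - (k + 1) = r := by omega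
    refine ⟨by simp [s, hr, unary_succ], ?_⟩
    rcases lt_or_ge k v with hkv | hkv
    · obtain ⟨w, hw⟩ : ∃ w, v - k = w + 1 := ⟨v - k - 1, by omega⟩
      have hw' : v - (k + 1) = w := by omega
      refine ((Runs.pop 6 _).seq (Runs.branch_cons (b := true)
        (l := unary w ++ false :: rest) ?_ ((Runs.pop 1 _).seq
          (runs_emit 5 (blk false) _)))).congr ?_ ?_
      · simp [s, hw, unary_succ]
      · funext j
        by_cases h5 : j = 5
        · subst h5; simp [s, levelBits_succ, decide_eq_false (not_le.2 hkv)]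
        by_cases h1 : j = 1
        · subst h1; simp [s, hw, hw', unary_succ]
        by_cases h6 : j = 6
        · subst h6; simp [s, hr, hr', unary_succ]
        · simp [s, h1, h5, h6]
      · have := hc false; omega
    · have hw : v - k = 0 := by omega
      have hw' : v - (k + 1) = 0 := by omega
      refine ((Runs.pop 6 _).seq (Runs.branch_cons (b := false)
        (l := rest) ?_ (runs_emit 5 (blk true) _))).congr ?_ ?_
      · simp [s, hw, unary]
      · funext j
        by_cases h5 : j = 5
        · subst h5; simp [s, levelBits_succ, hkv]
        by_cases h1 : j = 1
        · subst h1; simp [s, hw, hw', unary]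
        by_cases h6 : j = 6
        · subst h6; simp [s, hr, hr', unary_succ]
        · simp [s, h1, h5, h6]
      · have := hc true; omega
  have hs0 : update m 6 (unary N) = s 0 := by
    funext j
    simp only [s, update_apply]
    split_ifs <;> simp_all [levelBits]
  rw [hs0] at hcopy
  refine (hcopy.seq (hloop.seq (Runs.pop 1 _))).congr ?_ ?_
  · funext j
    simp only [s, update_apply]
    have : v - N = 0 := by omega
    split_ifs <;> simp_all [unary]
  · rw [show 2 * c + 6 + 1 = 2 * c + 7 by rfl]; omega

lemma runs_rep_emitVertex (blk : Bool → List Bool) {c : ℕ} (hc : ∀ b, (blk b).length ≤ c)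
    {N : ℕ} (vs : List ℕ) (hv : ∀ v ∈ vs, v ≤ N) {rest : List Bool} {m : Memory}
    (h0 : m 0 = unary N) (h4 : m 4 = []) (h6 : m 6 = []) (h1 : m 1 = vertexCode vs ++ rest) :
    Runs (.rep (.emitVertex blk) vs.length) m
      (update (update m 1 rest) 5 (((vs.flatMap (levelBits N)).flatMap blk).reverse ++ m 5))
      (vs.length * (12 * N + (N * (2 * c + 7)) + 9) + 1) := by
  induction vs generalizing m with
  | nil =>
    refine (Runs.skip m).congr ?_ (by omega)
    have h1' : rest = m 1 := by rw [h1]; rfl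
    simp [h1']
  | cons v vs ih =>
    have h := runs_emitVertex blk hc (hv v (by simp)) (rest := vertexCode vs ++ rest) h0 h4 h6
      (by rw [h1]; simp [vertexCode])
    refine (h.seq (ih (fun w hw => hv w (by simp [hw])) ?_ ?_ ?_ ?_)).congr ?_ ?_
    · simp [h0]
    · simp [h4]
    · simp [h6]
    · simp
    · funext j
      simp only [update_apply]
      split_ifs <;> simp_all
    · simp only [List.length_cons]
      rw [add_mul]; omega

lemma runs_emitEdge (K : ℕ) (cc : Bool → List Bool) {c : ℕ}
    (hc : ∀ b, ((List.replicate (2 ^ K) false ++ [b]).flatMap cc).length ≤ c)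
    {N : ℕ} (e : Fin K ↪ Fin N) {rest : List Bool} {m : Memory} (h0 : m 0 = unary N)
    (h4 : m 4 = []) (h6 : m 6 = []) (h1 : m 1 = vertexCode (vertices e) ++ rest) :
    Runs (.emitEdge K cc) m
      (update (update m 1 rest) 5 (((encodeEdge e).flatMap cc).reverse ++ m 5))
      (K * (12 * N + (N * (2 * c + 7)) + 9) + 4 * c + 3) := by
  have hlen : (vertices e).length = K := by simp [vertices]
  have h := runs_rep_emitVertex _ hc (vertices e) (fun v hv => by
    obtain ⟨k, rfl⟩ := (List.mem_ofFn ..).1 hv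
    exact (e k).2.le) h0 h4 h6 h1
  rw [hlen] at h
  refine (h.seq (runs_emit 5 _ _)).congr ?_ ?_
  · funext j
    simp only [update_apply]
    split_ifs <;> simp_all [encodeEdge, encodeVertices, spread, List.flatMap_assoc]
  · have h1 := hc true
    have h2 := hc false
    have h3 : ((spread (2 ^ K) [true, false]).flatMap cc).length =
      ((List.replicate (2 ^ K) false ++ [true]).flatMap cc).length +
        ((List.replicate (2 ^ K) false ++ [false]).flatMap cc).length := by
      simp [spread, List.flatMap_append]; omega
    omega

/-- A decision tree of fixed depth. Its leaves may depend on the bits in any way, so `coinIndex` is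
built in as a table and need not be computed. -/
lemma runs_readBits (a : ℕ) {n : ℕ} {leaf : List Bool → Prog} {bs rest : List Bool}
    {m m' : Memory} {B : ℕ} (hbs : bs.length = n) (ha : m a = bs ++ rest)
    (h : Runs (leaf bs) (update m a rest) m' B) :
    Runs (.readBits a n leaf) m m' (B + 3 * n) := by
  induction n generalizing leaf bs m with
  | zero =>
    obtain rfl := List.length_eq_zero_iff.1 hbs
    have : update m a rest = m := by
      have : rest = m a := by rw [ha]; rfl
      simp [this]
    rw [this] at h
    exact h
  | succ n ih =>
    obtain ⟨b, bs, rfl⟩ := List.exists_cons_of_length_eq_add_one hbs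
    refine (Runs.branch_cons (b := b) (l := bs ++ rest) (B := B + 3 * n + 2) (by simpa using ha)
      ?_).mono (by omega)
    have h2 : Runs (.seq (.pop a) (.readBits a n fun l => leaf (b :: l))) m m'
        (1 + (B + 3 * n) + 1) := by
      refine (Runs.pop a m).seq (ih (bs := bs) (by simpa using hbs) (by simp [ha]) ?_)
      simpa using h
    have h3 := h2.mono (show 1 + (B + 3 * n) + 1 ≤ B + 3 * n + 2 by omega)
    cases b <;> exact h3

/-! ### Simulated training sets -/

/-- The element of `Fin (2 ^ K)` chosen by `K` coins. -/
noncomputable def coinIndex (K : ℕ) (c : List Bool) : Fin (2 ^ K) :=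
  assignmentEquiv K fun k => c.getD k false

/-- The training set simulated from labelled hyperedges and coins. -/
noncomputable def simulate {K N : ℕ} :
    List ((Fin K ↪ Fin N) × Bool) → List Bool → List (List Bool × List Bool)
  | [], _ => []
  | (e, y) :: tr, cs =>
    (encodeEdge e, stepCot K y (coinIndex K (cs.take K))) :: simulate tr (cs.drop K)

/-- The codes of the hyperedges in the input of a distinguisher. -/
def edgesCode {K N : ℕ} (ls : List ((Fin K ↪ Fin N) × Bool)) : List Bool :=
  ls.flatMap fun a => vertexCode (vertices a.1)

variable {K N : ℕ}

/-- The program that simulates a training example. -/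
noncomputable def Prog.emitExample (K : ℕ) : Prog :=
  .seq (emitEdge K fun b => [true, b]) (readBits 2 1 fun y => readBits 3 K fun c =>
    emit 5 (false :: encodeString (stepCot K (y.getD 0 false) (coinIndex K c))))

lemma length_encodeString (l : List Bool) : (encodeString l).length = 2 * l.length + 1 := by
  simp [encodeString, List.length_flatMap, mul_comm]

lemma exists_runs_emitExample (K : ℕ) : ∃ τ, PolyBdd τ ∧ ∀ (N : ℕ) (e : Fin K ↪ Fin N) (y : Bool)
    (c r : List Bool) (ls : List ((Fin K ↪ Fin N) × Bool)) (m : Memory), m 0 = unary N → m 4 = [] →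
    m 6 = [] → m 1 = edgesCode ((e, y) :: ls) → m 2 = ((e, y) :: ls).map Prod.snd →
    c.length = K → m 3 = c ++ r →
    Runs (.emitExample K) m (update (update (update (update m 1 (edgesCode ls)) 2 (ls.map Prod.snd))
      3 r) 5 ((encodeString (encodeEdge e) ++
        encodeString (stepCot K y (coinIndex K c))).reverse ++ m 5)) (τ N) := by
  -- The code of a block: `2 ^ K + 1` tokens, each preceded by `true`.
  set c0 := 2 * (2 ^ K + 1) with hc0
  refine ⟨fun N => (K * (12 * N + (N * (2 * c0 + 7)) + 9) + 4 * c0 + 3) +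
    (2 * (2 * 2 ^ K + 2) + 1 + 3 * K + 3) + 1, ?_, ?_⟩
  · repeat' first | exact PolyBdd.const _ | exact PolyBdd.id | apply PolyBdd.add | apply PolyBdd.mul
  intro N e y c r ls m h0 h4 h6 h1 h2 hc h3
  have hE := runs_emitEdge K (fun b => [true, b]) (c := c0) (fun b => by
    simp [List.length_flatMap, hc0]; omega) e (rest := edgesCode ls) h0 h4 h6
    (by rw [h1]; simp [edgesCode])
  set m1 := update (update m 1 (edgesCode ls)) 5
    (((encodeEdge e).flatMap fun b => [true, b]).reverse ++ m 5) with hm1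
  have hc3 := runs_readBits 3 (leaf := fun c => .emit 5 (false :: encodeString
      (stepCot K y (coinIndex K c)))) (bs := c) (rest := r) (m := update m1 2 (ls.map Prod.snd)) hc
    (by simp [hm1, h3]) (runs_emit 5 _ _)
  have hc2 := runs_readBits 2 (leaf := fun y => .readBits 3 K fun c => .emit 5 (false ::
      encodeString (stepCot K (y.getD 0 false) (coinIndex K c)))) (bs := [y])
    (rest := ls.map Prod.snd) (m := m1) rfl (by simp [hm1, h2]) hc3
  refine (hE.seq hc2).congr ?_ ?_
  · funext j
    by_cases h5 : j = 5
    · subst h5; simp [hm1, encodeString]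
    by_cases h3 : j = 3
    · subst h3; simp
    by_cases h2 : j = 2
    · subst h2; simp
    by_cases h1 : j = 1
    · subst h1; simp [hm1]
    · simp [hm1, h1, h2, h3, h5]
  · simp [length_encodeString, stepCot]

lemma exists_runs_emitSample (K : ℕ) : ∃ τ, PolyBdd τ ∧ ∀ (N : ℕ)
    (tr ls : List ((Fin K ↪ Fin N) × Bool)) (cs r : List Bool) (m : Memory), m 0 = unary N →
    m 4 = [] → m 6 = [] → m 7 = unary tr.length → m 1 = edgesCode (tr ++ ls) →
    m 2 = (tr ++ ls).map Prod.snd → cs.length = tr.length * K → m 3 = cs ++ r →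
    Runs (.loop 7 (.seq (.pop 7) (.emitExample K))) m
      (update (update (update (update (update m 1 (edgesCode ls)) 2 (ls.map Prod.snd)) 3 r) 7 [])
        5 ((encodeSample (simulate tr cs)).reverse ++ m 5)) (tr.length * (τ N + 3) + 1) := by
  obtain ⟨τ, hτ, h⟩ := exists_runs_emitExample K
  refine ⟨τ, hτ, ?_⟩
  intro N tr
  induction tr with
  | nil =>
    intro ls cs r m h0 h4 h6 h7 h1 h2 hc h3
    obtain rfl := List.length_eq_zero_iff.1 (hc.trans (zero_mul K))
    refine (Runs.loop_nil (by rw [h7]; rfl)).congr ?_ (by omega)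
    funext j
    simp only [update_apply]
    split_ifs <;> simp_all [encodeSample, simulate, unary]
  | cons a tr ih =>
    intro ls cs r m h0 h4 h6 h7 h1 h2 hc h3
    obtain ⟨e, y⟩ := a
    have hsplit : cs = cs.take K ++ cs.drop K := (List.take_append_drop K cs).symm
    have hlen : (cs.take K).length = K := by
      rw [List.length_take, hc, List.length_cons, add_mul]; omega
    have hb := (Runs.pop 7 m).seq (h N e y (cs.take K) (cs.drop K ++ r) (tr ++ ls)
      (update m 7 (m 7).tail) (by simp [h0]) (by simp [h4]) (by simp [h6]) (by simp [h1])
      (by simp [h2]) hlen (by simp [h3, ← List.append_assoc]))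
    refine (Runs.loop_cons (by rw [h7]; simp [unary]) hb (ih ls (cs.drop K) r _ ?_ ?_ ?_ ?_ ?_ ?_ ?_
      ?_)).congr ?_ ?_
    · simp [h0]
    · simp [h4]
    · simp [h6]
    · simp [h7, unary_succ]
    · simp
    · simp
    · rw [List.length_drop, hc, List.length_cons, add_mul]; omega
    · simp
    · funext j
      by_cases h5 : j = 5
      · subst h5; simp [encodeSample, simulate]
      by_cases h7 : j = 7
      · subst h7; simp
      by_cases h3 : j = 3
      · subst h3; simp
      by_cases h2 : j = 2
      · subst h2; simp
      by_cases h1 : j = 1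
      · subst h1; simp
      · simp [h1, h2, h3, h5, h7]
    · rw [List.length_cons, add_mul]; omega

end Thinkers

namespace Thinkers

open Function

/-! ### Simulating one run of the learner -/

/-- Stack `i` of the `k`-th subprogram. -/
def ns (k i : ℕ) : ℕ := Nat.pair k i + 20

/-- The offset `20` separates private stacks from the shared ones. Every call uses a new `k`, so
whatever a subprogram leaves behind need not be cleaned up. -/
lemma ns_injective (k : ℕ) : Injective (ns k) := fun i j h => by simpa [ns] using h

lemma not_mem_range_ns {k j : ℕ} (hj : j < 20) : j ∉ Set.range (ns k) := by
  rintro ⟨i, rfl⟩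
  simp [ns] at hj

lemma ns_not_mem_range {k k' i : ℕ} (h : k' ≠ k) : ns k' i ∉ Set.range (ns k) := by
  rintro ⟨j, hj⟩
  simp [ns] at hj
  exact h hj.1.symm

variable {K N : ℕ}

/-- The memory between two subprograms: the remaining labelled hyperedges are `ls`, the remaining
coins `r`, the subprograms from the `k`-th on have not been used. -/
structure Ready (N k : ℕ) (ls : List ((Fin K ↪ Fin N) × Bool)) (r : List Bool) (cnt : ℕ)
    (flag : Bool) (m : Memory) : Prop where
  size : m 0 = unary N
  edges : m 1 = edgesCode ls
  labels : m 2 = ls.map Prod.snd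
  coins : m 3 = r
  four : m 4 = []
  five : m 5 = []
  six : m 6 = []
  seven : m 7 = []
  flag : m 8 = [] ↔ flag = false
  count : m 9 = unary cnt
  ten : m 10 = []
  fresh : ∀ k' ≥ k, ∀ i, m (ns k' i) = []

/-- The window size as a polynomial. -/
noncomputable def windowPoly (K : ℕ) : Polynomial ℕ :=
  (Polynomial.C (K + 1) * Polynomial.X + Polynomial.C 2) * Polynomial.C (2 ^ K + 1)

lemma eval_windowPoly (K N : ℕ) : (windowPoly K).eval N = window K N := by
  simp [windowPoly, window]

lemma eval_comp_windowPoly (p : Polynomial ℕ) (K N : ℕ) :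
    (p.comp (windowPoly K)).eval N = p.eval (window K N) := by
  rw [Polynomial.eval_comp, eval_windowPoly]

lemma polyBdd_window (K : ℕ) : PolyBdd fun N => window K N :=
  ⟨windowPoly K, fun N => (eval_windowPoly K N).ge⟩

lemma polyBdd_eval_window (p : Polynomial ℕ) (K : ℕ) : PolyBdd fun N => p.eval (window K N) :=
  ⟨p.comp (windowPoly K), fun N => (eval_comp_windowPoly p K N).ge⟩

lemma length_simulate (tr : List ((Fin K ↪ Fin N) × Bool)) (cs : List Bool) :
    (simulate tr cs).length = tr.length := by
  induction tr generalizing cs with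
  | nil => rfl
  | cons a tr ih => simp [simulate, ih]

lemma simulate_wf (tr : List ((Fin K ↪ Fin N) × Bool)) (cs : List Bool) :
    ∀ e ∈ simulate tr cs, e.1.length ≤ window K N ∧ e.2.length = 2 ^ K := by
  induction tr generalizing cs with
  | nil => simp [simulate]
  | cons a tr ih =>
    intro e he
    rw [simulate, List.mem_cons] at he
    rcases he with rfl | he
    · exact ⟨length_encodeEdge_le _, by simp [stepCot]⟩
    · exact ih _ e he

lemma length_encodeSample_le {a b : ℕ} (S : List (List Bool × List Bool))
    (hS : ∀ e ∈ S, e.1.length ≤ a ∧ e.2.length = b) :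
    (encodeSample S).length ≤ S.length * (2 * a + 2 * b + 2) := by
  induction S with
  | nil => simp [encodeSample]
  | cons e S ih =>
    have h1 := hS e (by simp)
    have h2 := ih fun e he => hS e (by simp [he])
    rw [encodeSample] at h2
    rw [encodeSample, List.flatMap_cons, List.length_append, List.length_append,
      length_encodeString, length_encodeString, List.length_cons, add_mul]
    omega

lemma runs_takeBits (c r : List Bool) (m : Memory) (h7 : m 7 = unary c.length)
    (h3 : m 3 = c ++ r) :
    Runs (.loop 7 (.seq (.pop 7) (.readBits 3 1 (.emit 5)))) m
      (update (update (update m 7 []) 3 r) 5 (c.reverse ++ m 5)) (c.length * 9 + 1) := by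
  induction c generalizing m with
  | nil =>
    refine (Runs.loop_nil (by rw [h7]; rfl)).congr ?_ (by omega)
    funext j
    simp only [update_apply]
    split_ifs <;> simp_all [unary]
  | cons b c ih =>
    have h := runs_readBits 3 (leaf := .emit 5) (bs := [b]) (rest := c ++ r)
      (m := update m 7 (m 7).tail) rfl (by simp [h3]) (runs_emit 5 _ _)
    refine (Runs.loop_cons (by rw [h7]; simp [unary]) ((Runs.pop 7 m).seq h)
      (ih _ ?_ ?_)).congr ?_ ?_
    · simp [h7, unary_succ]
    · simp
    · funext j
      by_cases h5 : j = 5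
      · subst h5; simp
      by_cases h3 : j = 3
      · subst h3; simp
      by_cases h7 : j = 7
      · subst h7; simp
      · simp [h3, h5, h7]
    · simp; omega

/-- The five inputs of the training program are laid out on its private stacks; the binary digits of
`2 ^ K` are hard-wired. The time bound applies to any well-formed training set, hence also to one
simulated from random labels. -/
lemma exists_train (L : Learner) (K k : ℕ) : ∃ (Q : Prog) (τ : ℕ → ℕ), PolyBdd τ ∧
    ∀ (N : ℕ) (tr ls : List ((Fin K ↪ Fin N) × Bool)) (cs c r : List Bool) (cnt : ℕ) (flag : Bool)
      (m : Memory), Ready N k (tr ++ ls) (cs ++ (c ++ r)) cnt flag m →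
      tr.length = L.samples.eval (window K N) → cs.length = tr.length * K →
      c.length = L.coins.eval (window K N) → L.RunsInTime (window K N) (2 ^ K) (2 ^ K) →
      ∃ m', Runs Q m m' (τ N) ∧ Ready N (k + 1) ls r cnt flag m' ∧
        m' (ns k 0) = L.rep (window K N) (2 ^ K) (2 ^ K) (simulate tr cs) c := by
  obtain ⟨Q1, τ1, hτ1, hQ1⟩ := exists_unaryEval (a := 0) (b := 4) (c := 10) (o := 7) (by decide)
    (by decide) (by decide) (by decide) (by decide) (by decide) (L.samples.comp (windowPoly K))
  obtain ⟨Q2, τ2, hτ2, hQ2⟩ := exists_unaryEval (a := 0) (b := 4) (c := 10) (o := 7) (by decide)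
    (by decide) (by decide) (by decide) (by decide) (by decide) (L.coins.comp (windowPoly K))
  obtain ⟨Q3, τ3, hτ3, hQ3⟩ := exists_unaryEval (a := 0) (b := 4) (c := 10) (o := 7) (by decide)
    (by decide) (by decide) (by decide) (by decide) (by decide) (windowPoly K)
  obtain ⟨τs, hτs, hs⟩ := exists_runs_emitSample K
  refine ⟨.seq Q1 (.seq (.loop 7 (.seq (.pop 7) (.emitExample K))) (.seq (.move 5 (ns k 3))
    (.seq Q2 (.seq (.loop 7 (.seq (.pop 7) (.readBits 3 1 (.emit 5)))) (.seq (.move 5 (ns k 4))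
    (.seq Q3 (.seq (.move 7 (ns k 0)) (.seq (.emit (ns k 1) (Nat.bits (2 ^ K)).reverse)
    (.seq (.emit (ns k 2) (Nat.bits (2 ^ K)).reverse) (L.train.rename (ns k))))))))))),
    fun N => τ1 N + ((L.samples.eval (window K N) * (τs N + 3) + 1) +
      ((5 * (L.samples.eval (window K N) * (2 * window K N + 2 * 2 ^ K + 2)) + 1) +
      (τ2 N + ((L.coins.eval (window K N) * 9 + 1) + ((5 * L.coins.eval (window K N) + 1) +
      (τ3 N + ((5 * window K N + 1) + ((2 * (Nat.bits (2 ^ K)).length + 1) +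
      ((2 * (Nat.bits (2 ^ K)).length + 1) + L.time.eval (window K N) + 1)
      + 1) + 1) + 1) + 1) + 1) + 1) + 1) + 1) + 1, ?_, ?_⟩
  · repeat' first | assumption | exact PolyBdd.const _ | exact PolyBdd.id |
      exact polyBdd_window K | exact polyBdd_eval_window _ K | apply PolyBdd.add |
      apply PolyBdd.mul
  intro N tr ls cs c r cnt flag m hm htr hcs hc hL
  have r1 := hQ1 N m hm.size hm.four hm.ten hm.seven
  rw [eval_comp_windowPoly, ← htr] at r1
  set m1 := update m 7 (unary tr.length) with hm1
  have r2 := hs N tr ls cs (c ++ r) m1 (by simp [hm1, hm.size]) (by simp [hm1, hm.four])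
    (by simp [hm1, hm.six]) (by simp [hm1]) (by simp [hm1, hm.edges]) (by simp [hm1, hm.labels])
    hcs (by simp [hm1, hm.coins])
  set m2 := update (update (update (update (update m1 1 (edgesCode ls)) 2 (ls.map Prod.snd)) 3
    (c ++ r)) 7 []) 5 ((encodeSample (simulate tr cs)).reverse ++ m1 5) with hm2
  have r3 := runs_move (a := 5) (b := ns k 3) (by simp [ns]) m2
  set m3 := update (update m2 5 []) (ns k 3) ((m2 5).reverse ++ m2 (ns k 3)) with hm3
  have r4 := hQ2 N m3 (by simp [hm3, hm2, hm1, ns, hm.size]) (by simp [hm3, hm2, hm1, ns, hm.four])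
    (by simp [hm3, hm2, hm1, ns, hm.ten]) (by simp [hm3, hm2, ns])
  rw [eval_comp_windowPoly, ← hc] at r4
  set m4 := update m3 7 (unary c.length) with hm4
  have r5 := runs_takeBits c r m4 (by simp [hm4]) (by simp [hm4, hm3, hm2, ns])
  set m5 := update (update (update m4 7 []) 3 r) 5 (c.reverse ++ m4 5) with hm5
  have r6 := runs_move (a := 5) (b := ns k 4) (by simp [ns]) m5
  set m6 := update (update m5 5 []) (ns k 4) ((m5 5).reverse ++ m5 (ns k 4)) with hm6
  have r7 := hQ3 N m6 (by simp [hm6, hm5, hm4, hm3, hm2, hm1, ns, hm.size])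
    (by simp [hm6, hm5, hm4, hm3, hm2, hm1, ns, hm.four])
    (by simp [hm6, hm5, hm4, hm3, hm2, hm1, ns, hm.ten]) (by simp [hm6, hm5, ns])
  rw [eval_windowPoly] at r7
  set m7 := update m6 7 (unary (window K N)) with hm7
  have r8 := runs_move (a := 7) (b := ns k 0) (by simp [ns]) m7
  set m8 := update (update m7 7 []) (ns k 0) ((m7 7).reverse ++ m7 (ns k 0)) with hm8
  have r9 := runs_emit (ns k 1) (Nat.bits (2 ^ K)).reverse m8
  set m9 := update m8 (ns k 1) ((Nat.bits (2 ^ K)).reverse.reverse ++ m8 (ns k 1)) with hm9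
  have r10 := runs_emit (ns k 2) (Nat.bits (2 ^ K)).reverse m9
  set m10 := update m9 (ns k 2) ((Nat.bits (2 ^ K)).reverse.reverse ++ m9 (ns k 2)) with hm10
  have h25 : m2 5 = (encodeSample (simulate tr cs)).reverse := by simp [hm2, hm1, hm.five]
  have h55 : m5 5 = c.reverse := by simp [hm5, hm4, hm3, ns]
  have h77 : m7 7 = unary (window K N) := by simp [hm7]
  have hfr : ∀ i, m (ns k i) = [] := hm.fresh k le_rfl
  have hns : ∀ k' i, m2 (ns k' i) = m (ns k' i) := by intro k' i; simp [hm2, hm1, ns]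
  have hin : ∀ i, m10 (ns k i) = (Learner.trainInput (window K N) (2 ^ K) (2 ^ K)
      (simulate tr cs) c).getD i [] := by
    intro i
    rcases i with _ | _ | _ | _ | _ | i
    · have : m7 (ns k 0) = [] := by
        simp [hm7, hm6, hm5, hm4, hm3, ns]
        simpa [ns] using (hns k 0).trans (hfr 0)
      rw [hm10, hm9, update_of_ne (by simp [ns]), update_of_ne (by simp [ns]), hm8, update_self,
        this, h77, reverse_unary]
      simp [Learner.trainInput]
    · have : m8 (ns k 1) = [] := by
        simp [hm8, hm7, hm6, hm5, hm4, hm3, ns]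
        simpa [ns] using (hns k 1).trans (hfr 1)
      rw [hm10, hm9, update_of_ne (by simp [ns]), update_self, this]
      simp [Learner.trainInput]
    · have : m9 (ns k 2) = [] := by
        simp [hm9, hm8, hm7, hm6, hm5, hm4, hm3, ns]
        simpa [ns] using (hns k 2).trans (hfr 2)
      rw [hm10, update_self, this]
      simp [Learner.trainInput]
    · have : m10 (ns k 3) = m3 (ns k 3) := by
        simp [hm10, hm9, hm8, hm7, hm6, hm5, hm4, ns]
      rw [this, hm3, update_self, h25, hns, hfr]
      simp [Learner.trainInput]
    · have : m10 (ns k 4) = m6 (ns k 4) := by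
        simp [hm10, hm9, hm8, hm7, ns]
      have h2 : m5 (ns k 4) = m2 (ns k 4) := by
        simp [hm5, hm4, hm3, ns]
      rw [this, hm6, update_self, h55, h2, hns, hfr]
      simp [Learner.trainInput]
    · have : m10 (ns k (i + 5)) = m2 (ns k (i + 5)) := by
        simp [hm10, hm9, hm8, hm7, hm6, hm5, hm4, hm3, ns]
      rw [this, hns, hfr]
      simp [Learner.trainInput]
  have hhalt := (hL (simulate tr cs) c ((length_simulate _ _).trans htr) (simulate_wf tr cs) hc).1
  obtain ⟨m11, r11, hout, hm11⟩ := runs_rename (ns_injective k) hhalt hin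
  refine ⟨m11, (r1.seq (r2.seq (r3.seq (r4.seq (r5.seq (r6.seq (r7.seq (r8.seq (r9.seq
    (r10.seq r11)))))))))).mono ?_, ?_, hout⟩
  · have hle := length_encodeSample_le (simulate tr cs) (simulate_wf tr cs)
    rw [length_simulate, htr] at hle
    rw [h25, h55, h77, List.length_reverse, List.length_reverse, length_unary, List.length_reverse,
      htr, hc]
    dsimp only
    omega
  · have hlow : ∀ j < 20, m11 j = m7 j ∨ j = 7 := by
      intro j hj
      rcases eq_or_ne j 7 with h | h
      · exact Or.inr h
      · left
        rw [hm11 j (not_mem_range_ns hj), hm10, hm9, hm8]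
        have : ∀ i, j ≠ ns k i := fun i => by unfold ns; omega
        simp [h, this]
    have h7 : m11 7 = [] := by
      rw [hm11 7 (not_mem_range_ns (by decide))]
      simp [hm10, hm9, hm8, ns]
    have hl : ∀ j < 20, j ≠ 7 → m11 j = m7 j := fun j hj h => (hlow j hj).resolve_right h
    constructor
    · rw [hl 0 (by decide) (by decide)]; simp [hm7, hm6, hm5, hm4, hm3, hm2, hm1, ns, hm.size]
    · rw [hl 1 (by decide) (by decide)]; simp [hm7, hm6, hm5, hm4, hm3, hm2, ns]
    · rw [hl 2 (by decide) (by decide)]; simp [hm7, hm6, hm5, hm4, hm3, hm2, ns]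
    · rw [hl 3 (by decide) (by decide)]; simp [hm7, hm6, hm5, ns]
    · rw [hl 4 (by decide) (by decide)]; simp [hm7, hm6, hm5, hm4, hm3, hm2, hm1, ns, hm.four]
    · rw [hl 5 (by decide) (by decide)]; simp [hm7, hm6, ns]
    · rw [hl 6 (by decide) (by decide)]; simp [hm7, hm6, hm5, hm4, hm3, hm2, hm1, ns, hm.six]
    · exact h7
    · rw [hl 8 (by decide) (by decide), ← hm.flag]; simp [hm7, hm6, hm5, hm4, hm3, hm2, hm1, ns]
    · rw [hl 9 (by decide) (by decide)]; simp [hm7, hm6, hm5, hm4, hm3, hm2, hm1, ns, hm.count]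
    · rw [hl 10 (by decide) (by decide)]; simp [hm7, hm6, hm5, hm4, hm3, hm2, hm1, ns, hm.ten]
    · intro k' hk' i
      have hne : k' ≠ k := by omega
      rw [hm11 _ (ns_not_mem_range hne)]
      have := hm.fresh k' (by omega) i
      rw [← hns] at this
      rw [← this]
      simp [hm10, hm9, hm8, hm7, hm6, hm5, hm4, hm3, ns, hne]

/-! ### Testing a hypothesis -/

namespace Prog

/-- Run `p` if the content of stack `a` is `[true]` and `q` otherwise. -/
def ifAccept (a : ℕ) (p q : Prog) : Prog :=
  .branch a q q (.seq (.pop a) (.branch a p q q))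

end Prog

lemma runs_ifAccept {a : ℕ} {p q : Prog} {m : Memory} {f : List Bool → Memory} {B : ℕ}
    (hp : m a = [true] → Runs p (update m a []) (f []) B)
    (hq : m a ≠ [true] → ∀ l, Runs q (update m a l) (f l) B) :
    ∃ l, Runs (.ifAccept a p q) m (f l) (B + 4) := by
  rcases h : m a with _ | ⟨b, l⟩
  · have := hq (by simp [h]) (m a)
    rw [update_eq_self] at this
    exact ⟨m a, (Runs.branch_nil h this).mono (by omega)⟩
  cases b with
  | false =>
    have := hq (by simp [h]) (m a)
    rw [update_eq_self] at this
    exact ⟨m a, (Runs.branch_cons h (by simpa using this)).mono (by omega)⟩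
  | true =>
    have h1 := Runs.pop a m
    rw [h] at h1
    rcases l with _ | ⟨c, l⟩
    · exact ⟨[], Runs.branch_cons h (B := B + 3)
        ((h1.seq (Runs.branch_nil (by simp) (hp h))).mono (by omega))⟩
    · refine ⟨c :: l, Runs.branch_cons h (B := B + 3) ((h1.seq (Runs.branch_cons (b := c) (l := l)
        (B := B) (by simp) ?_)).mono (by omega))⟩
      have := hq (by simp [h]) (c :: l)
      cases c <;> simpa using this

/-- The predictor receives a copy of the representation, since it may destroy its input; the
original stays on `ns k 0` for later tests. -/
lemma exists_test (L : Learner) (K k k' : ℕ) (hk : k < k') : ∃ (Q : Prog) (τ : ℕ → ℕ), PolyBdd τ ∧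
    ∀ (N : ℕ) (e : Fin K ↪ Fin N) (y : Bool) (ls : List ((Fin K ↪ Fin N) × Bool))
      (c r : List Bool) (cnt : ℕ) (flag : Bool) (m : Memory),
      Ready N k' ((e, y) :: ls) r cnt flag m → m (ns k 0) = c →
      c.length ≤ window K N + L.time.eval (window K N) →
      L.predict.HaltsIn [c, encodeEdge e] (L.time.eval (window K N)) →
      ∃ m', Runs Q m m' (τ N) ∧ Ready N (k' + 1) ls r
        (if L.hyp (window K N) c (encodeEdge e) == y then cnt + 1 else cnt) flag m' ∧
        m' (ns k 0) = c := by
  set c0 := 2 ^ K + 1 with hc0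
  refine ⟨.seq (.copy (ns k 0) 4 (ns k' 0)) (.seq (.emitEdge K fun b => [b])
    (.seq (.move 5 (ns k' 1)) (.seq (L.predict.rename (ns k')) (.readBits 2 1 fun y =>
      .ifAccept (ns k' 0) (if y.getD 0 false then .push 9 true else .skip)
        (if y.getD 0 false then .skip else .push 9 true))))),
    fun N => (12 * (window K N + L.time.eval (window K N)) + 3) +
      ((K * (12 * N + (N * (2 * c0 + 7)) + 9) + 4 * c0 + 3) + ((5 * window K N + 1) +
      (L.time.eval (window K N) + (1 + 4 + 3 * 1) + 1) + 1) + 1) + 1, ?_, ?_⟩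
  · repeat' first | assumption | exact PolyBdd.const _ | exact PolyBdd.id |
      exact polyBdd_window K | exact polyBdd_eval_window _ K | apply PolyBdd.add |
      apply PolyBdd.mul
  intro N e y ls c r cnt flag m hm hc hlen hhalt
  have hkk : k ≠ k' := hk.ne
  have hfr : ∀ i, m (ns k' i) = [] := hm.fresh k' le_rfl
  have r1 := runs_copy (a := ns k 0) (b := 4) (c := ns k' 0) (by simp [ns]) (by simp [ns, hkk])
    (by simp [ns]) hm.four
  rw [hc, hfr, List.append_nil] at r1
  set m1 := update m (ns k' 0) c with hm1
  have r2 := runs_emitEdge K (fun b => [b]) (c := c0) (fun b => by simp [hc0]) e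
    (rest := edgesCode ls) (m := m1) (by simp [hm1, ns, hm.size]) (by simp [hm1, ns, hm.four])
    (by simp [hm1, ns, hm.six]) (by simp [hm1, ns, hm.edges, edgesCode])
  have h15 : m1 5 = [] := by simp [hm1, ns, hm.five]
  rw [h15, List.append_nil, List.flatMap_singleton'] at r2
  set m2 := update (update m1 1 (edgesCode ls)) 5 (encodeEdge e).reverse with hm2
  have h25 : m2 5 = (encodeEdge e).reverse := by simp [hm2]
  have r3 := runs_move (a := 5) (b := ns k' 1) (by simp [ns]) m2
  have h2n : m2 (ns k' 1) = [] := by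
    rw [hm2, update_of_ne (by simp [ns]), update_of_ne (by simp [ns]), hm1,
      update_of_ne (by simp [ns]), hfr]
  rw [h25, h2n, List.append_nil, List.reverse_reverse, List.length_reverse] at r3
  set m3 := update (update m2 5 []) (ns k' 1) (encodeEdge e) with hm3
  have hin : ∀ i, m3 (ns k' i) = [c, encodeEdge e].getD i [] := by
    intro i
    rcases i with _ | _ | i
    · simp [hm3, hm2, hm1, ns]
    · rw [hm3, update_self]; simp
    · have : m3 (ns k' (i + 2)) = m (ns k' (i + 2)) := by simp [hm3, hm2, hm1, ns]
      rw [this, hfr]; simp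
  obtain ⟨m4, r4, hout, hm4⟩ := runs_rename (ns_injective k') hhalt hin
  have hlow : ∀ j < 20, m4 j = m3 j := fun j hj => hm4 j (not_mem_range_ns hj)
  set cnt' := if L.hyp (window K N) c (encodeEdge e) == y then cnt + 1 else cnt with hcnt'
  have h49 : m4 9 = unary cnt := by
    rw [hlow 9 (by decide)]; simp [hm3, hm2, hm1, ns, hm.count]
  have h42 : m4 2 = [y] ++ ls.map Prod.snd := by
    rw [hlow 2 (by decide)]; simp [hm3, hm2, hm1, ns, hm.labels]
  set m5 := update m4 2 (ls.map Prod.snd) with hm5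
  have h5a : m5 (ns k' 0) = L.predict.output [c, encodeEdge e] (L.time.eval (window K N)) := by
    rw [hm5, update_of_ne (by simp [ns]), hout]
  have h59 : m5 9 = unary cnt := by simp [hm5, h49]
  obtain ⟨l, r5⟩ := runs_ifAccept (a := ns k' 0) (p := if y then .push 9 true else .skip)
    (q := if y then .skip else .push 9 true) (m := m5)
    (f := fun l => update (update m5 (ns k' 0) l) 9 (unary cnt')) (B := 1) (by
      intro h
      have hh : L.hyp (window K N) c (encodeEdge e) = true := by
        rw [Learner.hyp, ← h5a, h]; simp
      rw [hh] at hcnt'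
      cases y with
      | true =>
        refine (Runs.push 9 true _).congr ?_ le_rfl
        rw [update_of_ne (by simp [ns]), h59, hcnt']
        rfl
      | false =>
        refine (Runs.skip _).congr ?_ le_rfl
        have : unary cnt' = update m5 (ns k' 0) [] 9 := by
          rw [update_of_ne (by simp [ns]), h59, hcnt']; rfl
        rw [this, update_eq_self]) (by
      intro h l
      have hh : L.hyp (window K N) c (encodeEdge e) = false := by
        rw [Learner.hyp, ← h5a]; simp [h]
      rw [hh] at hcnt'
      cases y with
      | false =>
        refine (Runs.push 9 true _).congr ?_ le_rfl
        rw [update_of_ne (by simp [ns]), h59, hcnt']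
        rfl
      | true =>
        refine (Runs.skip _).congr ?_ le_rfl
        have : unary cnt' = update m5 (ns k' 0) l 9 := by
          rw [update_of_ne (by simp [ns]), h59, hcnt']; rfl
        rw [this, update_eq_self])
  have r6 := runs_readBits 2 (leaf := fun y => .ifAccept (ns k' 0)
    (if y.getD 0 false then .push 9 true else .skip)
    (if y.getD 0 false then .skip else .push 9 true)) (bs := [y]) rfl h42 r5
  refine ⟨_, (r1.seq (r2.seq (r3.seq (r4.seq r6)))).mono ?_, ?_, ?_⟩
  · have := length_encodeEdge_le e
    simp only [List.length_singleton]
    omega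
  · have hl : ∀ j < 20, j ≠ 9 → update (update m5 (ns k' 0) l) 9 (unary cnt') j = m5 j := by
      intro j hj h
      rw [update_of_ne h, update_of_ne (by unfold ns; omega)]
    have hl' : ∀ j < 20, j ≠ 9 → j ≠ 2 →
        update (update m5 (ns k' 0) l) 9 (unary cnt') j = m3 j := by
      intro j hj h h'
      rw [hl j hj h, hm5, update_of_ne h', hlow j hj]
    constructor
    · rw [hl' 0 (by decide) (by decide) (by decide)]; simp [hm3, hm2, hm1, ns, hm.size]
    · rw [hl' 1 (by decide) (by decide) (by decide)]; simp [hm3, hm2, ns]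
    · rw [hl 2 (by decide) (by decide)]; simp [hm5]
    · rw [hl' 3 (by decide) (by decide) (by decide)]; simp [hm3, hm2, hm1, ns, hm.coins]
    · rw [hl' 4 (by decide) (by decide) (by decide)]; simp [hm3, hm2, hm1, ns, hm.four]
    · rw [hl' 5 (by decide) (by decide) (by decide)]; simp [hm3, ns]
    · rw [hl' 6 (by decide) (by decide) (by decide)]; simp [hm3, hm2, hm1, ns, hm.six]
    · rw [hl' 7 (by decide) (by decide) (by decide)]; simp [hm3, hm2, hm1, ns, hm.seven]
    · rw [hl' 8 (by decide) (by decide) (by decide), ← hm.flag]; simp [hm3, hm2, hm1, ns]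
    · rw [update_self]
    · rw [hl' 10 (by decide) (by decide) (by decide)]; simp [hm3, hm2, hm1, ns, hm.ten]
    · intro k'' hk'' i
      have hne : k'' ≠ k' := by omega
      have h1 : update (update m5 (ns k' 0) l) 9 (unary cnt') (ns k'' i) = m4 (ns k'' i) := by
        simp [hm5, ns, hne]
      rw [h1, hm4 _ (ns_not_mem_range hne), ← hm.fresh k'' (by omega) i]
      simp [hm3, hm2, hm1, ns, hne]
  · have h1 : update (update m5 (ns k' 0) l) 9 (unary cnt') (ns k 0) = m4 (ns k 0) := by
      simp [hm5, ns, hkk]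
    rw [h1, hm4 _ (ns_not_mem_range hkk), ← hc]
    simp [hm3, hm2, hm1, ns, hkk]

/-- The number of labelled hyperedges on which a hypothesis is correct. -/
def correct (L : Learner) (c : List Bool) (te : List ((Fin K ↪ Fin N) × Bool)) : ℕ :=
  te.countP fun a => L.hyp (window K N) c (encodeEdge a.1) == a.2

/-- The number `n` does not depend on `N`, so the tests are written out one after the other, each
with its own stacks. -/
lemma exists_tests (L : Learner) (K k n : ℕ) : ∀ k', k < k' → ∃ (Q : Prog) (τ : ℕ → ℕ),
    PolyBdd τ ∧ ∀ (N : ℕ) (te ls : List ((Fin K ↪ Fin N) × Bool)) (c r : List Bool) (cnt : ℕ)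
      (flag : Bool) (m : Memory), te.length = n →
      Ready N k' (te ++ ls) r cnt flag m → m (ns k 0) = c →
      c.length ≤ window K N + L.time.eval (window K N) →
      (∀ e : Fin K ↪ Fin N, L.predict.HaltsIn [c, encodeEdge e] (L.time.eval (window K N))) →
      ∃ m', Runs Q m m' (τ N) ∧ Ready N (k' + n) ls r (cnt + correct L c te) flag m' := by
  induction n with
  | zero =>
    intro k' _
    refine ⟨.skip, fun _ => 1, .const 1, fun N te ls c r cnt flag m hte hm _ _ _ =>
      ⟨m, Runs.skip m, ?_⟩⟩
    obtain rfl := List.length_eq_zero_iff.1 hte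
    simpa [correct] using hm
  | succ n ih =>
    intro k' hk
    obtain ⟨Q1, τ1, hτ1, h1⟩ := exists_test L K k k' hk
    obtain ⟨Q2, τ2, hτ2, h2⟩ := ih (k' + 1) (by omega)
    refine ⟨.seq Q1 Q2, fun N => τ1 N + τ2 N + 1, (hτ1.add hτ2).add (.const 1), ?_⟩
    intro N te ls c r cnt flag m hte hm hc hlen hhalt
    obtain ⟨⟨e, y⟩, te, rfl⟩ := List.exists_cons_of_length_eq_add_one hte
    obtain ⟨m1, r1, hm1, hc1⟩ := h1 N e y (te ++ ls) c r cnt flag m hm hc hlen (hhalt e)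
    obtain ⟨m2, r2, hm2⟩ := h2 N te ls c r _ flag m1 (by simpa using hte) hm1 hc1 hlen hhalt
    refine ⟨m2, r1.seq r2, ?_⟩
    convert hm2 using 1
    · omega
    · rw [correct, List.countP_cons, correct]
      split_ifs <;> omega

/-! ### The distinguisher -/

/-- Whether a hypothesis trained on the labelled hyperedges `tr` is correct on more than `θ` of the
labelled hyperedges `te`. -/
noncomputable def accepts (L : Learner) (θ : ℕ) (tr te : List ((Fin K ↪ Fin N) × Bool))
    (cs c : List Bool) : Bool :=
  decide (θ < correct L (L.rep (window K N) (2 ^ K) (2 ^ K) (simulate tr cs) c) te)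

/-- Stack `9` counts correct predictions in unary. After `θ` pops it is non-empty exactly when the
count exceeds `θ`; stack `8` records this, and the counter is cleared for the next round. -/
lemma exists_round (L : Learner) (K n θ k : ℕ) : ∃ (Q : Prog) (τ : ℕ → ℕ), PolyBdd τ ∧
    ∀ (N : ℕ) (tr te ls : List ((Fin K ↪ Fin N) × Bool)) (cs c r : List Bool)
      (flag : Bool) (m : Memory), Ready N k (tr ++ (te ++ ls)) (cs ++ (c ++ r)) 0 flag m →
      tr.length = L.samples.eval (window K N) → te.length = n → cs.length = tr.length * K →
      c.length = L.coins.eval (window K N) → L.RunsInTime (window K N) (2 ^ K) (2 ^ K) →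
      ∃ m', Runs Q m m' (τ N) ∧
        Ready N (k + 1 + n) ls r 0 (accepts L θ tr te cs c || flag) m' := by
  obtain ⟨Q1, τ1, hτ1, h1⟩ := exists_train L K k
  obtain ⟨Q2, τ2, hτ2, h2⟩ := exists_tests L K k n (k + 1) (by omega)
  refine ⟨.seq Q1 (.seq Q2 (.seq (.rep (.pop 9) θ) (.seq (.branch 9 .skip (.push 8 true)
    (.push 8 true)) (.clear 9)))), fun N => τ1 N + (τ2 N + ((2 * θ + 1) + ((1 + 1) + (2 * n + 1) + 1)
      + 1) + 1) + 1, ?_, ?_⟩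
  · repeat' first | assumption | exact PolyBdd.const _ | apply PolyBdd.add
  intro N tr te ls cs c r flag m hm htr hte hcs hc hL
  obtain ⟨m1, r1, hm1, hrep⟩ := h1 N tr (te ++ ls) cs c r 0 flag m hm htr hcs hc hL
  have hLS := hL (simulate tr cs) c ((length_simulate _ _).trans htr) (simulate_wf tr cs) hc
  have hlen : (L.rep (window K N) (2 ^ K) (2 ^ K) (simulate tr cs) c).length ≤
      window K N + L.time.eval (window K N) := by
    refine (length_output_le _ _ _).trans ?_
    simp [Learner.trainInput, length_unary]
  obtain ⟨m2, r2, hm2⟩ := h2 N te ls _ r 0 flag m1 hte hm1 hrep hlen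
    fun e => hLS.2 _ (length_encodeEdge_le e)
  set q := correct L (L.rep (window K N) (2 ^ K) (2 ^ K) (simulate tr cs) c) te with hq
  rw [zero_add] at hm2
  have hqn : q ≤ n := hte ▸ List.countP_le_length
  have r3 := runs_rep_pop 9 θ m2
  have hdrop : (m2 9).drop θ = unary (q - θ) := by rw [hm2.count]; simp [unary]
  rw [hdrop] at r3
  set m3 := update m2 9 (unary (q - θ)) with hm3
  have hacc : accepts L θ tr te cs c = decide (θ < q) := rfl
  obtain ⟨fl, r4, hfl⟩ : ∃ fl, Runs (.branch 9 .skip (.push 8 true) (.push 8 true)) m3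
      (update m3 8 fl) (1 + 1) ∧ (fl = [] ↔ (accepts L θ tr te cs c || flag) = false) := by
    by_cases h : θ < q
    · obtain ⟨w, hw⟩ : ∃ w, q - θ = w + 1 := ⟨q - θ - 1, by omega⟩
      refine ⟨true :: m3 8, Runs.branch_cons (b := true) (l := unary w) (by simp [hm3, hw,
        unary_succ]) (Runs.push 8 true m3), by simp [hacc, h]⟩
    · have hw : q - θ = 0 := by omega
      refine ⟨m3 8, ?_, ?_⟩
      · rw [update_eq_self]
        exact Runs.branch_nil (by simp [hm3, hw, unary]) (Runs.skip m3)
      · simp only [hacc, h, decide_false, Bool.false_or, ← hm2.flag, hm3]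
        simp
  have r5 := runs_clear 9 (update m3 8 fl)
  refine ⟨_, (r1.seq (r2.seq (r3.seq (r4.seq r5)))).mono ?_, ?_⟩
  · have : (update m3 8 fl 9).length = q - θ := by simp [hm3, length_unary]
    rw [this]
    dsimp only
    omega
  · have hl : ∀ j, j ≠ 8 → j ≠ 9 → update (update m3 8 fl) 9 [] j = m2 j := by
      intro j h8 h9
      simp [hm3, h8, h9]
    constructor
    · rw [hl _ (by decide) (by decide), hm2.size]
    · rw [hl _ (by decide) (by decide), hm2.edges]
    · rw [hl _ (by decide) (by decide), hm2.labels]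
    · rw [hl _ (by decide) (by decide), hm2.coins]
    · rw [hl _ (by decide) (by decide), hm2.four]
    · rw [hl _ (by decide) (by decide), hm2.five]
    · rw [hl _ (by decide) (by decide), hm2.six]
    · rw [hl _ (by decide) (by decide), hm2.seven]
    · rw [update_of_ne (by decide), update_self, hfl]
    · simp [unary]
    · rw [hl _ (by decide) (by decide), hm2.ten]
    · intro k' hk' i
      rw [hl _ (by simp [ns]) (by simp [ns]), hm2.fresh k' hk' i]

/-- Whether one of `R` rounds, which use consecutive parts of the labelled hyperedges and of the
coins, accepts. Every round uses `a` hyperedges and `a * K` coins to simulate a training set, `b`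
coins for the training and `n` hyperedges to test the hypothesis. -/
noncomputable def acceptsSome (L : Learner) (θ a n b : ℕ) :
    ℕ → List ((Fin K ↪ Fin N) × Bool) → List Bool → Bool
  | 0, _, _ => false
  | R + 1, ls, r =>
    accepts L θ (ls.take a) ((ls.drop a).take n) (r.take (a * K)) ((r.drop (a * K)).take b) ||
      acceptsSome L θ a n b R ((ls.drop a).drop n) ((r.drop (a * K)).drop b)

lemma exists_rounds (L : Learner) (K n θ R : ℕ) : ∀ k, ∃ (Q : Prog) (τ : ℕ → ℕ), PolyBdd τ ∧
    ∀ (N : ℕ) (ls : List ((Fin K ↪ Fin N) × Bool)) (r : List Bool) (flag : Bool) (m : Memory),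
      Ready N k ls r 0 flag m → R * (L.samples.eval (window K N) + n) ≤ ls.length →
      R * (L.samples.eval (window K N) * K + L.coins.eval (window K N)) ≤ r.length →
      L.RunsInTime (window K N) (2 ^ K) (2 ^ K) →
      ∃ m', Runs Q m m' (τ N) ∧ m' 0 = unary N ∧
        (m' 8 = [] ↔ (acceptsSome L θ (L.samples.eval (window K N)) n
          (L.coins.eval (window K N)) R ls r || flag) = false) := by
  induction R with
  | zero =>
    intro k
    exact ⟨.skip, fun _ => 1, .const 1, fun N ls r flag m hm _ _ _ =>
      ⟨m, Runs.skip m, hm.size, by simpa [acceptsSome] using hm.flag⟩⟩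
  | succ R ih =>
    intro k
    obtain ⟨Q1, τ1, hτ1, h1⟩ := exists_round L K n θ k
    obtain ⟨Q2, τ2, hτ2, h2⟩ := ih (k + 1 + n)
    refine ⟨.seq Q1 Q2, fun N => τ1 N + τ2 N + 1, (hτ1.add hτ2).add (.const 1), ?_⟩
    intro N ls r flag m hm hls hr hL
    set a := L.samples.eval (window K N) with ha
    set b := L.coins.eval (window K N) with hb
    rw [add_mul, one_mul] at hls hr
    have e1 : ls = ls.take a ++ ((ls.drop a).take n ++ (ls.drop a).drop n) := by simp
    have e2 : r = r.take (a * K) ++ ((r.drop (a * K)).take b ++ (r.drop (a * K)).drop b) := by simp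
    have hl1 : (ls.take a).length = a := by rw [List.length_take]; omega
    obtain ⟨m1, r1, hm1⟩ := h1 N (ls.take a) ((ls.drop a).take n) ((ls.drop a).drop n)
      (r.take (a * K)) ((r.drop (a * K)).take b) ((r.drop (a * K)).drop b) flag m
      (by rw [← e1, ← e2]; exact hm) hl1
      (by rw [List.length_take, List.length_drop]; omega)
      (by rw [List.length_take, hl1]; omega)
      (by rw [List.length_take, List.length_drop]; omega) hL
    obtain ⟨m2, r2, h20, h28⟩ := h2 N _ _ _ m1 hm1
      (by rw [List.length_drop, List.length_drop, ← ha]; omega)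
      (by rw [List.length_drop, List.length_drop, ← ha, ← hb]; omega) hL
    refine ⟨m2, r1.seq r2, h20, ?_⟩
    rw [h28, acceptsSome, Bool.or_left_comm, Bool.or_assoc]

/-- The input of the distinguisher, from labelled hyperedges and coins. -/
def labelledInput (ls : List ((Fin K ↪ Fin N) × Bool)) (r : List Bool) : List (List Bool) :=
  [unary N, edgesCode ls, ls.map Prod.snd, r]

/-- A distinguisher must halt in time for every `N`, but the learner is only controlled for large
sizes. Stack `11` holds a copy of `N` shortened by `N₀`, and the rounds run only if it is non-empty.
-/
lemma exists_distinguisher (L : Learner) (K n θ R N₀ : ℕ) : ∃ (A : Prog) (τ : Polynomial ℕ),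
    ∀ (N : ℕ) (ls : List ((Fin K ↪ Fin N) × Bool)) (r : List Bool),
      (N₀ < N → R * (L.samples.eval (window K N) + n) ≤ ls.length ∧
        R * (L.samples.eval (window K N) * K + L.coins.eval (window K N)) ≤ r.length ∧
        L.RunsInTime (window K N) (2 ^ K) (2 ^ K)) →
      A.HaltsIn (labelledInput ls r) (τ.eval N) ∧ (N₀ < N →
        (A.output (labelledInput ls r) (τ.eval N) = [true] ↔
          acceptsSome L θ (L.samples.eval (window K N)) n (L.coins.eval (window K N)) R ls r
            = true)) := by
  obtain ⟨Q, τ, hτ, h⟩ := exists_rounds L K n θ R 0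
  let A : Prog := .seq (.copy 0 4 11) (.seq (.rep (.pop 11) N₀) (.seq (.branch 11 .skip Q Q)
    (.seq (.clear 0) (.branch 8 .skip (.push 0 true) (.push 0 true)))))
  have hp : PolyBdd fun N => (12 * N + 3) + ((2 * N₀ + 1) + ((τ N + 1 + 1) + ((2 * N + 1) +
      (1 + 1) + 1) + 1) + 1) + 1 := by
    repeat' first | assumption | exact PolyBdd.const _ | exact PolyBdd.id | apply PolyBdd.add |
      apply PolyBdd.mul
  obtain ⟨p, hp⟩ := hp
  refine ⟨A, p, fun N ls r hN => ?_⟩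
  set m : Memory := fun i => (labelledInput ls r).getD i [] with hm
  have r1 := runs_copy (a := 0) (b := 4) (c := 11) (by decide) (by decide) (by decide) (m := m) rfl
  have e1 : m 0 ++ m 11 = unary N := by simp [hm, labelledInput]
  rw [e1, show (m 0).length = N from length_unary N] at r1
  set m1 := update m 11 (unary N) with hm1
  have r2 := runs_rep_pop 11 N₀ m1
  have e2 : (m1 11).drop N₀ = unary (N - N₀) := by simp [hm1, unary]
  rw [e2] at r2
  set m2 := update m1 11 (unary (N - N₀)) with hm2
  obtain ⟨m3, r3, h30, h38⟩ : ∃ m3, Runs (.branch 11 .skip Q Q) m2 m3 (τ N + 1 + 1) ∧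
      m3 0 = unary N ∧ (N₀ < N → (m3 8 = [] ↔ acceptsSome L θ (L.samples.eval (window K N)) n
        (L.coins.eval (window K N)) R ls r = false)) := by
    by_cases hlt : N₀ < N
    · obtain ⟨h1, h2, h3⟩ := hN hlt
      have hready : Ready N 0 ls r 0 false m2 := by
        constructor <;> first
          | intro k' _ i
            simp [hm2, hm1, hm, labelledInput, ns]
          | simp [hm2, hm1, hm, labelledInput, unary]
      obtain ⟨m3, r3, h30, h38⟩ := h N ls r false m2 hready h1 h2 h3
      obtain ⟨w, hw⟩ : ∃ w, N - N₀ = w + 1 := ⟨N - N₀ - 1, by omega⟩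
      refine ⟨m3, (Runs.branch_cons (b := true) (l := unary w) (by simp [hm2, hw, unary_succ])
        r3).mono (by omega), h30, fun _ => by simpa using h38⟩
    · have hw : N - N₀ = 0 := by omega
      refine ⟨m2, (Runs.branch_nil (by simp [hm2, hw, unary]) (Runs.skip m2)).mono (by omega), ?_,
        fun h => absurd h hlt⟩
      simp [hm2, hm1, hm, labelledInput]
  have r4 := runs_clear 0 m3
  rw [h30, length_unary] at r4
  obtain ⟨m5, r5, h5⟩ : ∃ m5, Runs (.branch 8 .skip (.push 0 true) (.push 0 true))
      (update m3 0 []) m5 (1 + 1) ∧ (m5 0 = [true] ↔ m3 8 ≠ []) := by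
    rcases h8 : m3 8 with _ | ⟨b, l⟩
    · exact ⟨_, Runs.branch_nil (by simp [h8]) (Runs.skip _), by simp⟩
    · refine ⟨_, Runs.branch_cons (b := b) (l := l) (by simp [h8])
        (m' := update (update m3 0 []) 0 [true]) ?_, by simp⟩
      have := Runs.push 0 true (update m3 0 [])
      cases b <;> simpa using this
  obtain ⟨hh, ho⟩ := (r1.seq (r2.seq (r3.seq (r4.seq r5)))).haltsIn (hp N)
  refine ⟨hh, fun hlt => ?_⟩
  rw [show A.output (labelledInput ls r) (p.eval N) = m5 0 from ho, h5, ne_eq, h38 hlt]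
  simp

end Thinkers

/-! ### Discrete probability: expectations, independent samples, a Chernoff bound -/

namespace Thinkers

open scoped ENNReal

/-! ### Expectations over discrete distributions -/

variable {α β : Type}

/-- The expectation of a non-negative function. -/
noncomputable def ex (p : PMF α) (f : α → ℝ≥0∞) : ℝ≥0∞ := ∑' a, p a * f a

open Classical in
/-- The probability of an event. -/
noncomputable def pr (p : PMF α) (E : α → Prop) : ℝ≥0∞ := ex p fun a => if E a then 1 else 0

lemma ex_pure (a : α) (f : α → ℝ≥0∞) : ex (PMF.pure a) f = f a := by
  rw [ex, tsum_eq_single a]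
  · simp
  · intro b hb
    simp [PMF.pure_apply, hb]

lemma ex_bind (p : PMF α) (g : α → PMF β) (f : β → ℝ≥0∞) :
    ex (p.bind g) f = ex p fun a => ex (g a) f := by
  simp only [ex, PMF.bind_apply, ← ENNReal.tsum_mul_right, ← ENNReal.tsum_mul_left]
  rw [ENNReal.tsum_comm]
  simp only [mul_assoc]

lemma ex_map (p : PMF α) (g : α → β) (f : β → ℝ≥0∞) : ex (p.map g) f = ex p fun a => f (g a) := by
  rw [← PMF.bind_pure_comp, ex_bind]
  simp only [Function.comp_apply, ex_pure]

lemma ex_const (p : PMF α) (c : ℝ≥0∞) : ex p (fun _ => c) = c := by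
  rw [ex, ENNReal.tsum_mul_right, p.tsum_coe, one_mul]

lemma ex_mono_support (p : PMF α) {f g : α → ℝ≥0∞} (h : ∀ a ∈ p.support, f a ≤ g a) :
    ex p f ≤ ex p g := by
  refine ENNReal.tsum_le_tsum fun a => ?_
  by_cases ha : a ∈ p.support
  · gcongr
    exact h a ha
  · simp [(PMF.apply_eq_zero_iff p a).2 ha]

lemma ex_mono (p : PMF α) {f g : α → ℝ≥0∞} (h : ∀ a, f a ≤ g a) : ex p f ≤ ex p g :=
  ex_mono_support p fun a _ => h a

lemma ex_add (p : PMF α) (f g : α → ℝ≥0∞) : ex p (fun a => f a + g a) = ex p f + ex p g := by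
  simp only [ex, mul_add, ENNReal.tsum_add]

lemma ex_mul_left (p : PMF α) (c : ℝ≥0∞) (f : α → ℝ≥0∞) :
    ex p (fun a => c * f a) = c * ex p f := by
  rw [ex, ex, ← ENNReal.tsum_mul_left]
  exact tsum_congr fun a => mul_left_comm _ _ _

lemma ex_mul_right (p : PMF α) (c : ℝ≥0∞) (f : α → ℝ≥0∞) :
    ex p (fun a => f a * c) = ex p f * c := by
  simp only [mul_comm _ c, ex_mul_left]

lemma ex_comm (p : PMF α) (q : PMF β) (f : α → β → ℝ≥0∞) :
    ex p (fun a => ex q fun b => f a b) = ex q fun b => ex p fun a => f a b := by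
  simp only [ex, ← ENNReal.tsum_mul_left]
  rw [ENNReal.tsum_comm]
  simp only [mul_left_comm]

lemma pr_eq_toOuterMeasure (p : PMF α) (E : α → Prop) : pr p E = p.toOuterMeasure {a | E a} := by
  rw [PMF.toOuterMeasure_apply, pr, ex]
  refine tsum_congr fun a => ?_
  by_cases h : E a <;> simp [h]

lemma pr_add_pr_not (p : PMF α) (E : α → Prop) : pr p E + pr p (fun a => ¬ E a) = 1 := by
  rw [pr, pr, ← ex_add]
  refine (congrArg (ex p) (funext fun a => ?_)).trans (ex_const p 1)
  by_cases h : E a <;> simp [h]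

lemma pr_le_one (p : PMF α) (E : α → Prop) : pr p E ≤ 1 :=
  (pr_add_pr_not p E) ▸ le_self_add

lemma pr_map (p : PMF α) (g : α → β) (E : β → Prop) :
    pr (p.map g) E = pr p fun a => E (g a) := ex_map _ _ _

/-! ### Independent samples -/

lemma ex_iid_succ (p : PMF α) (n : ℕ) (f : List α → ℝ≥0∞) :
    ex (iid p (n + 1)) f = ex p fun a => ex (iid p n) fun l => f (a :: l) := by
  rw [iid, ex_bind]
  simp only [ex_map]

lemma ex_iid_add (p : PMF α) (a b : ℕ) (f : List α → List α → ℝ≥0∞) :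
    ex (iid p (a + b)) (fun l => f (l.take a) (l.drop a)) =
      ex (iid p a) fun l => ex (iid p b) fun l' => f l l' := by
  induction a generalizing f with
  | zero => simp [iid, ex_pure]
  | succ a ih =>
    rw [show a + 1 + b = a + b + 1 by omega, ex_iid_succ, ex_iid_succ]
    congr 1
    funext x
    exact ih fun l l' => f (x :: l) l'

lemma iid_map (p : PMF α) (g : α → β) (n : ℕ) : iid (p.map g) n = (iid p n).map (List.map g) := by
  induction n with
  | zero => simp [iid, PMF.pure_map]
  | succ n ih =>
    rw [iid, iid, ih, PMF.bind_map, PMF.map_bind]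
    simp only [Function.comp_def, PMF.map_comp, List.map_cons]

lemma length_of_mem_support_iid (p : PMF α) (n : ℕ) :
    ∀ l ∈ (iid p n).support, l.length = n := by
  induction n with
  | zero => intro l hl; simpa [iid] using hl
  | succ n ih =>
    intro l hl
    rw [iid, PMF.mem_support_bind_iff] at hl
    obtain ⟨a, _, hl⟩ := hl
    rw [PMF.mem_support_map_iff] at hl
    obtain ⟨l', hl', rfl⟩ := hl
    simp [ih l' hl']

lemma ex_pow_countP (p : PMF α) (X : α → Bool) (t : ℝ≥0∞) (n : ℕ) :
    ex (iid p n) (fun l => t ^ l.countP X) = ex p (fun a => if X a then t else 1) ^ n := by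
  induction n with
  | zero => simp [iid, ex_pure]
  | succ n ih =>
    rw [ex_iid_succ, pow_succ', ← ih, ← ex_mul_right]
    congr 1
    funext a
    rw [← ex_mul_left]
    congr 1
    funext l
    by_cases h : X a <;> simp [h, pow_succ, mul_comm]

/-- Markov's inequality for `(1 + η) ^ countP`, whose expectation factors by independence. -/
lemma pr_le_countP_mul (p : PMF α) (X : α → Bool) (η q : ℝ≥0∞) (hq : pr p (fun a => X a) ≤ q)
    (n k : ℕ) : pr (iid p n) (fun l => k ≤ l.countP X) * (1 + η) ^ k ≤ (1 + η * q) ^ n := by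
  have h1 : ex p (fun a => if X a then 1 + η else 1) ≤ 1 + η * q := by
    calc ex p (fun a => if X a then 1 + η else 1)
        = ex p (fun a => 1 + η * (if X a then 1 else 0)) := by
          congr 1; funext a; by_cases h : X a <;> simp [h]
      _ = 1 + η * pr p (fun a => X a) := by
          rw [ex_add, ex_const, ex_mul_left, pr]
          congr 3; funext a; by_cases h : X a <;> simp [h]
      _ ≤ 1 + η * q := by gcongr
  refine le_trans ?_ (pow_le_pow_left' h1 n)
  rw [← ex_pow_countP, pr, ← ex_mul_right]
  refine ex_mono _ fun l => ?_
  split_ifs with h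
  · rw [one_mul]
    exact pow_le_pow_right₀ le_self_add h
  · simp

/-- The number of occurrences of an event of probability at most `q` among many independent samples
is rarely at least a fraction `θ > q`. -/
lemma exists_pr_le_countP_le {q θ τ : ℝ} (hq : 0 ≤ q) (hqθ : q < θ) (hθ : θ ≤ 1) (hτ : 0 < τ) :
    ∃ n₀ : ℕ, ∀ n ≥ n₀, ∀ (α : Type) (p : PMF α) (X : α → Bool),
      pr p (fun a => X a) ≤ ENNReal.ofReal q → ∀ k : ℕ, θ * n ≤ k →
      pr (iid p n) (fun l => k ≤ l.countP X) ≤ ENNReal.ofReal τ := by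
  -- With `1 + η = exp s`, the bound decays if `1 + (exp s - 1) * q < exp (s * θ)`. As `exp s - 1 ≤
  -- s + s ^ 2`, it suffices that `(1 + s) * q < θ`, which holds because `q + s < θ`.
  set s := (θ - q) / 2 with hs
  have hs0 : 0 < s := by rw [hs]; linarith
  have hs1 : s ≤ 1 := by rw [hs]; linarith
  have hexp : Real.exp s - 1 ≤ s + s ^ 2 := by
    have := (abs_le.1 (Real.abs_exp_sub_one_sub_id_le (x := s) (by rwa [abs_of_pos hs0]))).2
    linarith
  have hexp0 : 0 ≤ Real.exp s - 1 := by linarith [Real.add_one_le_exp s]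
  set A := 1 + (Real.exp s - 1) * q with hA
  have hA0 : 0 < A := by positivity
  have hAB : A < Real.exp (s * θ) := by
    have h1 : A ≤ 1 + (s + s ^ 2) * q := by rw [hA]; gcongr
    have h2 : 1 + (s + s ^ 2) * q < 1 + s * θ := by
      have : q * s ≤ s := by nlinarith
      have h3 : (1 + s) * q < θ := by nlinarith
      nlinarith
    linarith [Real.add_one_le_exp (s * θ)]
  have hB0 : 0 < Real.exp (s * θ) := Real.exp_pos _
  have hρ : A / Real.exp (s * θ) < 1 := (div_lt_one hB0).2 hAB
  -- Chosen before the distribution, so the number of tests can be a constant of the program.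
  obtain ⟨n₀, hn₀⟩ := exists_pow_lt_of_lt_one hτ hρ
  refine ⟨n₀, fun n hn α p X hX k hk => ?_⟩
  have h := pr_le_countP_mul p X (ENNReal.ofReal (Real.exp s - 1)) _ hX n k
  have e1 : (1 : ℝ≥0∞) + ENNReal.ofReal (Real.exp s - 1) = ENNReal.ofReal (Real.exp s) := by
    rw [← ENNReal.ofReal_one, ← ENNReal.ofReal_add zero_le_one hexp0]; congr 1; ring
  have e2 : (1 : ℝ≥0∞) + ENNReal.ofReal (Real.exp s - 1) * ENNReal.ofReal q =
      ENNReal.ofReal A := by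
    rw [← ENNReal.ofReal_mul hexp0, ← ENNReal.ofReal_one, ← ENNReal.ofReal_add zero_le_one
      (by positivity)]
  rw [e1, e2, ← ENNReal.ofReal_pow (Real.exp_pos _).le, ← ENNReal.ofReal_pow hA0.le] at h
  have hne : ENNReal.ofReal (Real.exp s ^ k) ≠ 0 := by
    simpa using pow_pos (Real.exp_pos s) k
  have h2 := (ENNReal.le_div_iff_mul_le (Or.inl hne) (Or.inl ENNReal.ofReal_ne_top)).2 h
  refine h2.trans ?_
  rw [← ENNReal.ofReal_div_of_pos (by positivity)]
  refine ENNReal.ofReal_le_ofReal ?_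
  have h3 : Real.exp (s * θ) ^ n ≤ Real.exp s ^ k := by
    rw [← Real.exp_nat_mul, ← Real.exp_nat_mul]
    refine Real.exp_le_exp.2 ?_
    nlinarith
  calc A ^ n / Real.exp s ^ k ≤ A ^ n / Real.exp (s * θ) ^ n := by gcongr
    _ = (A / Real.exp (s * θ)) ^ n := (div_pow _ _ _).symm
    _ ≤ (A / Real.exp (s * θ)) ^ n₀ := pow_le_pow_of_le_one (by positivity) hρ.le hn
    _ ≤ τ := hn₀.le

/-! ### Uniform distributions -/

lemma ex_uniform [Fintype α] [Nonempty α] (f : α → ℝ≥0∞) :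
    ex (PMF.uniformOfFintype α) f = (Fintype.card α : ℝ≥0∞)⁻¹ * ∑ a, f a := by
  rw [ex, tsum_fintype, Finset.mul_sum]
  simp only [PMF.uniformOfFintype_apply]

lemma ex_uniform_equiv [Fintype α] [Nonempty α] [Fintype β] [Nonempty β] (e : α ≃ β)
    (f : β → ℝ≥0∞) :
    ex (PMF.uniformOfFintype α) (fun a => f (e a)) = ex (PMF.uniformOfFintype β) f := by
  rw [ex_uniform, ex_uniform, Fintype.card_congr e, Equiv.sum_comp e f]

lemma ex_uniform_prod [Fintype α] [Nonempty α] [Fintype β] [Nonempty β] (f : α × β → ℝ≥0∞) :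
    ex (PMF.uniformOfFintype (α × β)) f =
      ex (PMF.uniformOfFintype α) fun a => ex (PMF.uniformOfFintype β) fun b => f (a, b) := by
  simp only [ex_uniform]
  rw [Fintype.sum_prod_type, Fintype.card_prod, Nat.cast_mul, ENNReal.mul_inv (by simp) (by simp),
    mul_assoc, Finset.mul_sum]

lemma ex_uniform_pi [Fintype α] [Nonempty α] (n : ℕ) (f : List α → ℝ≥0∞) :
    ex (PMF.uniformOfFintype (Fin n → α)) (fun v => f (List.ofFn v)) =
      ex (iid (PMF.uniformOfFintype α) n) f := by
  induction n generalizing f with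
  | zero => simp [iid, ex_pure, ex_uniform]
  | succ n ih =>
    rw [ex_iid_succ, ← ex_uniform_equiv (Fin.consEquiv fun _ => α), ex_uniform_prod]
    congr 1
    funext a
    rw [← ih]
    congr 1
    funext v
    simp [Fin.consEquiv, List.ofFn_succ]

lemma uprob_eq [Fintype α] [Nonempty α] (E : α → Prop) :
    uprob α E = (pr (PMF.uniformOfFintype α) E).toReal := by
  classical
  rw [uprob, pr, ex_uniform, Finset.sum_ite, Finset.sum_const_zero, add_zero, Finset.sum_const,
    nsmul_eq_mul, mul_one, ENNReal.toReal_mul, ENNReal.toReal_inv, ENNReal.toReal_natCast,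
    ENNReal.toReal_natCast, Nat.card_eq_fintype_card, Nat.card_eq_fintype_card,
    Fintype.card_subtype, div_eq_inv_mul]

lemma uprob_not [Fintype α] [Nonempty α] (E : α → Prop) :
    uprob α E = 1 - uprob α fun a => ¬ E a := by
  have h := pr_add_pr_not (PMF.uniformOfFintype α) E
  rw [uprob_eq, uprob_eq, eq_sub_iff_add_eq, ← ENNReal.toReal_add, h, ENNReal.toReal_one]
  · exact ((pr_le_one _ _).trans_lt ENNReal.one_lt_top).ne
  · exact ((pr_le_one _ _).trans_lt ENNReal.one_lt_top).ne

end Thinkers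

namespace Thinkers

open scoped ENNReal

variable {α : Type} {K N : ℕ}

/-! ### Splitting samples and comparing distributions through expectations -/

lemma ex_iid_add_add (p : PMF α) (a b c : ℕ) (f : List α → List α → List α → ℝ≥0∞) :
    ex (iid p (a + (b + c))) (fun l => f (l.take a) ((l.drop a).take b) ((l.drop a).drop b)) =
      ex (iid p a) fun l => ex (iid p b) fun l' => ex (iid p c) fun l'' => f l l' l'' := by
  rw [ex_iid_add p a (b + c) fun l l' => f l (l'.take b) (l'.drop b)]
  congr 1
  funext l
  exact ex_iid_add p b c fun l' l'' => f l l' l''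

lemma pmf_ext_ex {p q : PMF α} (h : ∀ f, ex p f = ex q f) : p = q := by
  classical
  refine PMF.ext fun a => ?_
  have := h fun b => if b = a then 1 else 0
  simpa [ex, tsum_ite_eq] using this

/-! ### The acceptance probability of the distinguisher -/

/-- A uniform coin. -/
noncomputable abbrev coin : PMF Bool := PMF.uniformOfFintype Bool

/-- A training example simulated from a random labelled hyperedge. -/
noncomputable def simulatedExample (p : PMF ((Fin K ↪ Fin N) × Bool)) :
    PMF (List Bool × List Bool) :=
  p.bind fun a => (iid coin K).map fun c => (encodeEdge a.1, stepCot K a.2 (coinIndex K c))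

/-- Each example uses its own hyperedge and its own `K` coins, so the simulated training set is
i.i.d. -/
lemma ex_simulate (p : PMF ((Fin K ↪ Fin N) × Bool)) (n : ℕ)
    (f : List (List Bool × List Bool) → ℝ≥0∞) :
    ex (iid p n) (fun tr => ex (iid coin (n * K)) fun cs => f (simulate tr cs)) =
      ex (iid (simulatedExample p) n) f := by
  induction n generalizing f with
  | zero => simp [iid, ex_pure, simulate]
  | succ n ih =>
    rw [ex_iid_succ, ex_iid_succ, simulatedExample, ex_bind]
    congr 1
    funext a
    rw [ex_map, show (n + 1) * K = K + n * K by ring]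
    have h : ∀ tr : List ((Fin K ↪ Fin N) × Bool),
        ex (iid coin (K + n * K)) (fun cs => f (simulate (a :: tr) cs)) =
        ex (iid coin K) fun c => ex (iid coin (n * K)) fun cs =>
          f ((encodeEdge a.1, stepCot K a.2 (coinIndex K c)) :: simulate tr cs) := fun tr =>
      ex_iid_add coin K (n * K) fun c cs =>
        f ((encodeEdge a.1, stepCot K a.2 (coinIndex K c)) :: simulate tr cs)
    simp only [h]
    rw [ex_comm]
    congr 1
    funext c
    exact ih fun S => f ((encodeEdge a.1, stepCot K a.2 (coinIndex K c)) :: S)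

/-- The probability that a round of the distinguisher does not accept. -/
noncomputable def rejectProb (L : Learner) (θ n : ℕ) (p : PMF ((Fin K ↪ Fin N) × Bool)) : ℝ≥0∞ :=
  ex (L.learned (window K N) (2 ^ K) (2 ^ K) (simulatedExample p)) fun c =>
    pr (iid p n) fun te => ¬ θ < correct L c te

/-- Test edges are independent of training data and coins, so the expectations may be exchanged to
draw the hypothesis first. -/
lemma ex_accepts (L : Learner) (θ n : ℕ) (p : PMF ((Fin K ↪ Fin N) × Bool)) :
    ex (iid p (L.samples.eval (window K N))) (fun tr => ex (iid p n) fun te =>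
      ex (iid coin (L.samples.eval (window K N) * K)) fun cs =>
        ex (iid coin (L.coins.eval (window K N))) fun c =>
          if accepts L θ tr te cs c then 0 else 1) = rejectProb L θ n p := by
  have h1 : ∀ tr : List ((Fin K ↪ Fin N) × Bool),
      (ex (iid p n) fun te => ex (iid coin (L.samples.eval (window K N) * K)) fun cs =>
        ex (iid coin (L.coins.eval (window K N))) fun c =>
          if accepts L θ tr te cs c then 0 else 1) =
      ex (iid coin (L.samples.eval (window K N) * K)) fun cs =>
        (fun S => ex (iid coin (L.coins.eval (window K N))) fun c => pr (iid p n) fun te =>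
          ¬ θ < correct L (L.rep (window K N) (2 ^ K) (2 ^ K) S c) te) (simulate tr cs) := by
    intro tr
    rw [ex_comm]
    congr 1
    funext cs
    rw [ex_comm]
    congr 1
    funext c
    rw [pr]
    congr 1
    funext te
    by_cases h : θ < correct L (L.rep (window K N) (2 ^ K) (2 ^ K) (simulate tr cs) c) te <;>
      simp [accepts, h]
  simp only [h1]
  rw [ex_simulate p _ fun S => ex (iid coin (L.coins.eval (window K N))) fun c =>
    pr (iid p n) fun te => ¬ θ < correct L (L.rep (window K N) (2 ^ K) (2 ^ K) S c) te,
    rejectProb, Learner.learned, ex_bind]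
  simp only [ex_map]

/-- Rounds use disjoint hyperedges and coins, so the event that all reject has a product
probability; the `M` surplus hyperedges average out. -/
lemma ex_acceptsSome (L : Learner) (θ n : ℕ) (p : PMF ((Fin K ↪ Fin N) × Bool)) (M R : ℕ) :
    ex (iid p (R * (L.samples.eval (window K N) + n) + M)) (fun ls =>
      ex (iid coin (R * (L.samples.eval (window K N) * K + L.coins.eval (window K N))))
        fun r => if acceptsSome L θ (L.samples.eval (window K N)) n (L.coins.eval (window K N))
          R ls r then 0 else 1) = rejectProb L θ n p ^ R := by
  induction R with
  | zero => simp [acceptsSome, ex_const]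
  | succ R ih =>
    rw [pow_succ', ← ih, ← ex_accepts]
    set a := L.samples.eval (window K N)
    set b := L.coins.eval (window K N)
    rw [show (R + 1) * (a + n) + M = a + (n + (R * (a + n) + M)) by ring,
      show (R + 1) * (a * K + b) = a * K + (b + R * (a * K + b)) by ring]
    let G := fun (tr te : List ((Fin K ↪ Fin N) × Bool)) (cs c : List Bool) =>
      if accepts L θ tr te cs c then (0 : ℝ≥0∞) else 1
    let H := fun (ls : List ((Fin K ↪ Fin N) × Bool)) (r : List Bool) =>
      if acceptsSome L θ a n b R ls r then (0 : ℝ≥0∞) else 1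
    have h1 : ∀ (ls : List ((Fin K ↪ Fin N) × Bool)) (r : List Bool),
        (if acceptsSome L θ a n b (R + 1) ls r then (0 : ℝ≥0∞) else 1) =
        G (ls.take a) ((ls.drop a).take n) (r.take (a * K)) ((r.drop (a * K)).take b) *
          H ((ls.drop a).drop n) ((r.drop (a * K)).drop b) := by
      intro ls r
      have h2 : ∀ u v : Bool, (if (u || v) = true then (0 : ℝ≥0∞) else 1) =
          (if u = true then 0 else 1) * (if v = true then 0 else 1) := by
        intro u v
        cases u <;> simp
      exact h2 _ _
    simp only [h1]
    rw [ex_iid_add_add p a n _ fun tr te ls => ex (iid coin (a * K + (b + R * (a * K + b))))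
      fun r => G tr te (r.take (a * K)) ((r.drop (a * K)).take b) *
        H ls ((r.drop (a * K)).drop b), ← ex_mul_right]
    congr 1
    funext tr
    rw [← ex_mul_right]
    congr 1
    funext te
    rw [← ex_mul_left]
    congr 1
    funext ls
    rw [ex_iid_add_add coin (a * K) b _ fun cs c r => G tr te cs c * H ls r, ← ex_mul_right]
    congr 1
    funext cs
    rw [← ex_mul_right]
    congr 1
    funext c
    rw [ex_mul_left]

/-! ### Pseudorandom labels -/

/-- A random hyperedge with its pseudorandom label. -/
noncomputable def labelledEdge [Nonempty (Fin K ↪ Fin N)] (P : (Fin K → Bool) → Bool)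
    (x : Fin N → Bool) : PMF ((Fin K ↪ Fin N) × Bool) :=
  (PMF.uniformOfFintype (Fin K ↪ Fin N)).map fun e => (e, P fun k => x (e k))

/-- The distribution of the instance of a random hyperedge. -/
noncomputable def edgeInstance (K N : ℕ) [Nonempty (Fin K ↪ Fin N)] : PMF (List Bool) :=
  (PMF.uniformOfFintype (Fin K ↪ Fin N)).map encodeEdge

lemma ex_coinIndex (K : ℕ) (f : Fin (2 ^ K) → ℝ≥0∞) :
    ex (iid coin K) (fun c => f (coinIndex K c)) = ex (PMF.uniformOfFintype (Fin (2 ^ K))) f := by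
  rw [← ex_uniform_pi K fun c => f (coinIndex K c), ← ex_uniform_equiv (assignmentEquiv K)]
  congr 1
  funext v
  congr 1
  rw [coinIndex]
  congr 1
  funext k
  simp

/-- The heart of the reduction. For a fixed index `i` of the restricted seed, `j ↦ i - j` permutes
`Fin (2 ^ K)`, so a uniform identity gives a uniform delay independent of the seed, exactly as drawn
by the coins. -/
lemma simulatedExample_labelledEdge [Nonempty (Fin K ↪ Fin N)] (P : (Fin K → Bool) → Bool)
    (x : Fin N → Bool) :
    simulatedExample (labelledEdge P x) =
      cotExample (edgeInstance K N) (seedThinker P x) (2 ^ K) := by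
  refine pmf_ext_ex fun f => ?_
  rw [simulatedExample, labelledEdge, cotExample, edgeInstance, ex_bind, ex_bind, ex_map, ex_map]
  congr 1
  funext e
  rw [ex_map, ex_map, ex_coinIndex K fun τ => f (encodeEdge e, stepCot K (P fun k => x (e k)) τ),
    ← ex_uniform_equiv (Equiv.subLeft (assignmentEquiv K fun k => x (e k)))]
  simp only [cot_seedThinker_encodeEdge, Equiv.subLeft_apply]

lemma correct_add_countP (L : Learner) (c : List Bool) (te : List ((Fin K ↪ Fin N) × Bool)) :
    correct L c te + te.countP (fun a => !(L.hyp (window K N) c (encodeEdge a.1) == a.2)) =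
      te.length := by
  rw [correct, List.length_eq_countP_add_countP
    (fun a : (Fin K ↪ Fin N) × Bool => L.hyp (window K N) c (encodeEdge a.1) == a.2)]
  congr 2
  funext a
  simp [Bool.beq_eq_decide_eq]

/-- With probability at least `1 - δ` the hypothesis has error at most `ε`, and then the test
rejects with probability at most one half; otherwise the trivial bound is used. -/
lemma rejectProb_labelledEdge [Nonempty (Fin K ↪ Fin N)] (P : (Fin K → Bool) → Bool)
    (x : Fin N → Bool) (L : Learner) {ε δ : ℝ} (hL : L.Learns ε δ (window K N) (2 ^ K) (2 ^ K))
    {θ n : ℕ} (hn : ∀ (p : PMF ((Fin K ↪ Fin N) × Bool)) (X : (Fin K ↪ Fin N) × Bool → Bool),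
      pr p (fun a => X a) ≤ ENNReal.ofReal ε →
      pr (iid p n) (fun l => n - θ ≤ l.countP X) ≤ ENNReal.ofReal (1 / 2)) :
    rejectProb L θ n (labelledEdge P x) + ENNReal.ofReal (1 - δ) * ENNReal.ofReal (1 / 2) ≤ 1 := by
  have h := hL (edgeInstance K N) (fun z hz => by
      rw [edgeInstance, PMF.mem_support_map_iff] at hz
      obtain ⟨e, _, rfl⟩ := hz
      exact length_encodeEdge_le e)
    (e2e (seedThinker P x 0) (2 ^ K)) ⟨_, seedThinker_mem P x 0, rfl⟩ (seedThinker P x)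
    (seedThinker_mem P x) (fun j => e2e_seedThinker_eq P x j 0)
  rw [← pr_eq_toOuterMeasure, ← simulatedExample_labelledEdge] at h
  refine (add_le_add le_rfl (mul_le_mul_left h _)).trans ?_
  rw [pr, ← ex_mul_right, rejectProb, ← ex_add]
  refine (ex_mono _ fun c => ?_).trans (ex_const _ 1).le
  split_ifs with hc
  · have herr : pr (labelledEdge P x)
        (fun a => (!(L.hyp (window K N) c (encodeEdge a.1) == a.2)) = true) ≤
          ENNReal.ofReal ε := by
      refine le_trans (le_of_eq ?_) hc
      rw [err, ← pr_eq_toOuterMeasure, edgeInstance, labelledEdge, pr_map, pr_map]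
      congr 1
      funext e
      rw [e2e_seedThinker_last]
      simp
    have h2 : pr (iid (labelledEdge P x) n) (fun te => ¬ θ < correct L c te) ≤
        ENNReal.ofReal (1 / 2) := by
      -- At most `θ` correct predictions means at least `n - θ` wrong ones.
      refine le_trans ?_ (hn _ _ herr)
      refine ex_mono_support _ fun te hte => ?_
      have hlen := length_of_mem_support_iid _ _ te hte
      have := correct_add_countP L c te
      split_ifs with h1 h2
      · exact le_rfl
      · omega
      · exact bot_le
      · exact le_rfl
    rw [one_mul]
    refine (add_le_add h2 le_rfl).trans ?_
    rw [← ENNReal.ofReal_add (by norm_num) (by norm_num)]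
    norm_num
  · rw [zero_mul, add_zero]
    exact pr_le_one _ _

/-! ### Random labels -/

/-- Fresh uniform labels are independent of the hypothesis, so any hypothesis whatsoever is right on
each with probability one half. -/
lemma one_le_rejectProb_add (L : Learner) [Nonempty (Fin K ↪ Fin N)] {θ n : ℕ} {τ : ℝ}
    (hn : ∀ (p : PMF ((Fin K ↪ Fin N) × Bool)) (X : (Fin K ↪ Fin N) × Bool → Bool),
      pr p (fun a => X a) ≤ ENNReal.ofReal (1 / 2) →
      pr (iid p n) (fun l => θ + 1 ≤ l.countP X) ≤ ENNReal.ofReal τ) :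
    1 ≤ rejectProb L θ n (PMF.uniformOfFintype ((Fin K ↪ Fin N) × Bool)) + ENNReal.ofReal τ := by
  set p := PMF.uniformOfFintype ((Fin K ↪ Fin N) × Bool)
  rw [rejectProb, ← ex_const (L.learned (window K N) (2 ^ K) (2 ^ K) (simulatedExample p))
    (ENNReal.ofReal τ), ← ex_add]
  refine (ex_const (L.learned (window K N) (2 ^ K) (2 ^ K) (simulatedExample p)) 1).ge.trans
    (ex_mono _ fun c => ?_)
  have h1 := hn p (fun a => L.hyp (window K N) c (encodeEdge a.1) == a.2) (by
    rw [pr, ex_uniform_prod]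
    refine (ex_mono _ fun e => ?_).trans (ex_const _ _).le
    rw [ex_uniform, Fintype.sum_bool, Fintype.card_bool,
      show ENNReal.ofReal (1 / 2) = ((2 : ℕ) : ℝ≥0∞)⁻¹ by
        rw [one_div, ENNReal.ofReal_inv_of_pos (by norm_num)]; norm_num]
    cases L.hyp (window K N) c (encodeEdge e) <;> simp)
  rw [← pr_add_pr_not (iid p n) fun te => θ < correct L c te, add_comm]
  gcongr
  exact h1

/-! ### The two distinguishing probabilities -/

lemma prgInput_eq {M q : ℕ} (G : Hypergraph N M K) (y : Fin M → Bool) (r : Fin q → Bool) :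
    prgInput G y r = labelledInput (List.ofFn fun i => (G i, y i)) (List.ofFn r) := by
  simp [prgInput, labelledInput, edgesCode, vertexCode, vertices, List.flatMap, List.map_ofFn,
    Function.comp_def]

/-- Once the seed is fixed, the labelled hyperedges are independent and identically distributed. -/
lemma ex_uniform_goldreich [Nonempty (Fin K ↪ Fin N)] (P : (Fin K → Bool) → Bool) (M q : ℕ)
    (f : List ((Fin K ↪ Fin N) × Bool) → List Bool → ℝ≥0∞) :
    ex (PMF.uniformOfFintype (Hypergraph N M K × (Fin N → Bool) × (Fin q → Bool)))
      (fun ω => f (List.ofFn fun i => (ω.1 i, goldreich P ω.1 ω.2.1 i)) (List.ofFn ω.2.2)) =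
    ex (PMF.uniformOfFintype (Fin N → Bool)) fun x => ex (iid (labelledEdge P x) M) fun ls =>
      ex (iid coin q) fun r => f ls r := by
  rw [ex_uniform_prod]
  simp only [ex_uniform_prod]
  rw [ex_comm]
  congr 1
  funext x
  rw [labelledEdge, iid_map, ex_map, ← ex_uniform_pi]
  congr 1
  funext G
  rw [← ex_uniform_pi, List.map_ofFn]
  rfl

lemma ex_uniform_labels [Nonempty (Fin K ↪ Fin N)] (M q : ℕ)
    (f : List ((Fin K ↪ Fin N) × Bool) → List Bool → ℝ≥0∞) :
    ex (PMF.uniformOfFintype (Hypergraph N M K × (Fin M → Bool) × (Fin q → Bool)))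
      (fun ω => f (List.ofFn fun i => (ω.1 i, ω.2.1 i)) (List.ofFn ω.2.2)) =
    ex (iid (PMF.uniformOfFintype ((Fin K ↪ Fin N) × Bool)) M) fun ls =>
      ex (iid coin q) fun r => f ls r := by
  rw [← ex_uniform_pi, ← ex_uniform_equiv (Equiv.arrowProdEquivProdArrow (Fin M)
    (fun _ => Fin K ↪ Fin N) (fun _ => Bool)).symm, ex_uniform_prod, ex_uniform_prod]
  congr 1
  funext G
  rw [ex_uniform_prod]
  congr 1
  funext y
  rw [← ex_uniform_pi]
  rfl

/-! ### Growth of the parameters and bounds on the two acceptance probabilities -/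

lemma eventually_eval_le_pow (p : Polynomial ℕ) {s : ℕ} (hs : p.natDegree < s) :
    ∀ᶠ n : ℕ in Filter.atTop, p.eval n ≤ n ^ s := by
  -- The value at `1` is the sum of the coefficients, absorbed by one extra factor `n`.
  filter_upwards [Filter.eventually_ge_atTop (max 1 (p.eval 1))] with n hn
  have h1 : 1 ≤ n := (le_max_left _ _).trans hn
  calc p.eval n = ∑ i ∈ Finset.range (p.natDegree + 1), p.coeff i * n ^ i :=
        Polynomial.eval_eq_sum_range n
    _ ≤ ∑ i ∈ Finset.range (p.natDegree + 1), p.coeff i * n ^ p.natDegree := by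
        refine Finset.sum_le_sum fun i hi => ?_
        rw [Finset.mem_range] at hi
        exact Nat.mul_le_mul_left _ (Nat.pow_le_pow_right h1 (by omega))
    _ = p.eval 1 * n ^ p.natDegree := by
        rw [← Finset.sum_mul, Polynomial.eval_eq_sum_range]
        simp
    _ ≤ n * n ^ p.natDegree := Nat.mul_le_mul_right _ ((le_max_right _ _).trans hn)
    _ = n ^ (p.natDegree + 1) := by ring
    _ ≤ n ^ s := Nat.pow_le_pow_right h1 hs

/-- The degree is bounded independently of `K`, so the stretch can be fixed before `K` is known. -/
lemma natDegree_windowPoly_le (K : ℕ) : (windowPoly K).natDegree ≤ 1 := by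
  unfold windowPoly
  compute_degree

/-- The factor `K + 1` instead of `K` in `window` secures this for `K = 0` too. -/
lemma le_window (K N : ℕ) : N ≤ window K N := by
  unfold window
  nlinarith [Nat.zero_le (K * N), Nat.zero_le ((K + 1) * N * 2 ^ K), Nat.zero_le (2 ^ K)]

/-- For each seed a round rejects with probability at most `1 - (1 - δ) / 2 = (1 + δ) / 2`, and
rounds are independent given the seed. -/
lemma uprob_goldreich_ge [Nonempty (Fin K ↪ Fin N)] (P : (Fin K → Bool) → Bool) (L : Learner)
    {ε δ : ℝ} (hδ : 0 < δ) (hδ' : δ < 1) (hL : L.Learns ε δ (window K N) (2 ^ K) (2 ^ K))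
    {θ n R M : ℕ} (hn : ∀ (p : PMF ((Fin K ↪ Fin N) × Bool)) (X : (Fin K ↪ Fin N) × Bool → Bool),
      pr p (fun a => X a) ≤ ENNReal.ofReal ε →
      pr (iid p n) (fun l => n - θ ≤ l.countP X) ≤ ENNReal.ofReal (1 / 2))
    (hM : R * (L.samples.eval (window K N) + n) ≤ M) :
    1 - ((1 + δ) / 2) ^ R ≤ uprob (Hypergraph N M K × (Fin N → Bool) ×
      (Fin (R * (L.samples.eval (window K N) * K + L.coins.eval (window K N))) → Bool))
      (fun ω => acceptsSome L θ (L.samples.eval (window K N)) n (L.coins.eval (window K N)) R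
        (List.ofFn fun i => (ω.1 i, goldreich P ω.1 ω.2.1 i)) (List.ofFn ω.2.2) = true) := by
  obtain ⟨M, rfl⟩ := Nat.exists_eq_add_of_le hM
  rw [uprob_not, uprob_eq]
  refine sub_le_sub_left (ENNReal.toReal_le_of_le_ofReal (by positivity) ?_) 1
  have h := ex_uniform_goldreich (N := N) P (R * (L.samples.eval (window K N) + n) + M)
    (R * (L.samples.eval (window K N) * K + L.coins.eval (window K N))) fun ls r =>
      if acceptsSome L θ (L.samples.eval (window K N)) n (L.coins.eval (window K N)) R ls r
        then 0 else 1
  simp only [ex_acceptsSome] at h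
  have h2 : ∀ x : Fin N → Bool, rejectProb L θ n (labelledEdge P x) ≤ ENNReal.ofReal ((1 + δ) / 2) := by
    intro x
    have h3 := rejectProb_labelledEdge P x L hL hn
    rw [← ENNReal.ofReal_mul (by linarith)] at h3
    refine (ENNReal.le_sub_of_add_le_right ENNReal.ofReal_ne_top h3).trans ?_
    rw [← ENNReal.ofReal_one, ← ENNReal.ofReal_sub _ (by nlinarith)]
    exact ENNReal.ofReal_le_ofReal (by linarith)
  rw [ENNReal.ofReal_pow (by positivity)]
  refine le_trans (le_of_eq ?_) ((ex_mono (PMF.uniformOfFintype (Fin N → Bool)) fun x =>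
    pow_le_pow_left' (h2 x) R).trans (ex_const _ _).le)
  rw [← h, pr]
  congr 1
  funext ω
  simp only [Bool.not_eq_true]
  split_ifs with h1 h2 <;> simp_all

lemma uprob_labels_le [Nonempty (Fin K ↪ Fin N)] (L : Learner) {θ n R M : ℕ} {τ : ℝ} (hτ : 0 ≤ τ)
    (hτ1 : τ ≤ 1)
    (hn : ∀ (p : PMF ((Fin K ↪ Fin N) × Bool)) (X : (Fin K ↪ Fin N) × Bool → Bool),
      pr p (fun a => X a) ≤ ENNReal.ofReal (1 / 2) →
      pr (iid p n) (fun l => θ + 1 ≤ l.countP X) ≤ ENNReal.ofReal τ)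
    (hM : R * (L.samples.eval (window K N) + n) ≤ M) :
    uprob (Hypergraph N M K × (Fin M → Bool) ×
      (Fin (R * (L.samples.eval (window K N) * K + L.coins.eval (window K N))) → Bool))
      (fun ω => acceptsSome L θ (L.samples.eval (window K N)) n (L.coins.eval (window K N)) R
        (List.ofFn fun i => (ω.1 i, ω.2.1 i)) (List.ofFn ω.2.2) = true) ≤ R * τ := by
  obtain ⟨M, rfl⟩ := Nat.exists_eq_add_of_le hM
  rw [uprob_not, uprob_eq]
  have h := ex_uniform_labels (K := K) (N := N) (R * (L.samples.eval (window K N) + n) + M)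
    (R * (L.samples.eval (window K N) * K + L.coins.eval (window K N))) fun ls r =>
      if acceptsSome L θ (L.samples.eval (window K N)) n (L.coins.eval (window K N)) R ls r
        then 0 else 1
  simp only [ex_acceptsSome] at h
  have h1 : pr (PMF.uniformOfFintype (Hypergraph N (R * (L.samples.eval (window K N) + n) + M) K ×
      (Fin (R * (L.samples.eval (window K N) + n) + M) → Bool) ×
      (Fin (R * (L.samples.eval (window K N) * K + L.coins.eval (window K N))) → Bool)))
      (fun ω => ¬ acceptsSome L θ (L.samples.eval (window K N)) n (L.coins.eval (window K N)) R
        (List.ofFn fun i => (ω.1 i, ω.2.1 i)) (List.ofFn ω.2.2) = true) =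
      rejectProb L θ n (PMF.uniformOfFintype ((Fin K ↪ Fin N) × Bool)) ^ R := by
    rw [← h, pr]
    congr 1
    funext ω
    simp only [Bool.not_eq_true]
    split_ifs with h1 h2 <;> simp_all
  rw [h1, ENNReal.toReal_pow]
  set ν := rejectProb L θ n (PMF.uniformOfFintype ((Fin K ↪ Fin N) × Bool)) with hν
  have hν1 : ν ≤ 1 := (ex_mono _ fun c => pr_le_one _ _).trans (ex_const _ 1).le
  have hνtop : ν ≠ ⊤ := (hν1.trans_lt ENNReal.one_lt_top).ne
  have h2 : 1 - τ ≤ ν.toReal := by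
    have h3 := one_le_rejectProb_add L hn
    have h4 := ENNReal.toReal_mono (ENNReal.add_ne_top.2 ⟨hνtop, ENNReal.ofReal_ne_top⟩) h3
    rw [ENNReal.toReal_add hνtop ENNReal.ofReal_ne_top, ENNReal.toReal_ofReal hτ,
      ENNReal.toReal_one] at h4
    linarith
  have h3 : (1 - τ) ^ R ≤ ν.toReal ^ R := pow_le_pow_left₀ (by linarith) h2 R
  -- Bernoulli's inequality, in place of a union bound over the rounds.
  have h4 := one_add_mul_le_pow (show -2 ≤ -τ by linarith) R
  have h5 : 1 + -τ = 1 - τ := by ring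
  rw [h5] at h4
  linarith

/-! ### Choice of the constants and the contradiction -/

theorem LocalPRGsExist.not_weaklyLearns (hPRG : LocalPRGsExist) {g : ℕ → ℕ}
    (hg : Filter.Tendsto g Filter.atTop Filter.atTop) (L : Learner) : ¬ L.WeaklyLearns g := by
  rintro ⟨ε, δ, hε, hε', hδ, hδ', hL⟩
  -- With this `R` and the `τ` below, pseudorandom labels are accepted with probability above `9 /
  -- 10` and random ones with probability at most `1 / 10`; the gap exceeds `1 / 3`.
  obtain ⟨R, hR⟩ := exists_pow_lt_of_lt_one (show (0 : ℝ) < 1 / 10 by norm_num)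
    (show (1 + δ) / 2 < 1 by linarith)
  set τ : ℝ := 1 / (10 * (R + 1)) with hτ
  have hτ0 : 0 < τ := by positivity
  have hRτ : R * τ ≤ 1 / 10 := by
    rw [hτ, mul_one_div, div_le_div_iff₀ (by positivity) (by norm_num)]
    linarith
  have hτ1 : τ ≤ 1 := by
    rw [hτ, div_le_one (by positivity)]
    have : (0 : ℝ) ≤ R := by positivity
    linarith
  -- The midpoint between `1 / 2` and `1 - ε`.
  set φ : ℝ := 3 / 4 - ε / 2 with hφ
  obtain ⟨n₁, hn₁⟩ := exists_pr_le_countP_le hε.le (show ε < 1 - φ by rw [hφ]; linarith)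
    (by rw [hφ]; linarith) (show (0 : ℝ) < 1 / 2 by norm_num)
  obtain ⟨n₂, hn₂⟩ := exists_pr_le_countP_le (show (0 : ℝ) ≤ 1 / 2 by norm_num)
    (show 1 / 2 < φ by rw [hφ]; linarith) (by rw [hφ]; linarith) hτ0
  set n := max n₁ n₂ with hn
  set θ := ⌊φ * n⌋₊ with hθ
  have hθ1 : (θ : ℝ) ≤ φ * n := Nat.floor_le (mul_nonneg (by rw [hφ]; linarith) n.cast_nonneg)
  have hθ2 : φ * n < θ + 1 := Nat.lt_floor_add_one _
  -- Depends on the learner only: `N ^ s` labels suffice for all rounds when `N` is large, and `s >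
  -- 1` even if the sample size is constant. The locality `K` is obtained after this choice.
  set s := L.samples.natDegree + 2 with hs
  obtain ⟨K, P, hP⟩ := hPRG s (by rw [hs]; exact_mod_cast (show 1 < L.samples.natDegree + 2 by omega))
  have hwin : Filter.Tendsto (window K) Filter.atTop Filter.atTop :=
    Filter.tendsto_atTop_mono (le_window K) Filter.tendsto_id
  have hpoly : ∀ᶠ N : ℕ in Filter.atTop, R * (L.samples.eval (window K N) + n) ≤ N ^ s := by
    have hd : (Polynomial.C R * (L.samples.comp (windowPoly K) + Polynomial.C n)).natDegree < s := by
      refine (Polynomial.natDegree_C_mul_le _ _).trans_lt ?_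
      rw [Polynomial.natDegree_add_C]
      refine Polynomial.natDegree_comp_le.trans_lt ?_
      have := Nat.mul_le_mul_left L.samples.natDegree (natDegree_windowPoly_le K)
      omega
    filter_upwards [eventually_eval_le_pow _ hd] with N hN
    simpa [eval_comp_windowPoly, Polynomial.eval_comp, eval_windowPoly] using hN
  have hgood : ∀ᶠ N : ℕ in Filter.atTop, R * (L.samples.eval (window K N) + n) ≤ N ^ s ∧ K ≤ N ∧
      L.RunsInTime (window K N) (2 ^ K) (2 ^ K) ∧ L.Learns ε δ (window K N) (2 ^ K) (2 ^ K) := by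
    -- Since `2 ^ K` is constant and `g` is unbounded, `2 ^ K` is eventually an admissible thinking
    -- length and number of thinkers; `K ≤ N` makes hyperedges exist.
    filter_upwards [hpoly, Filter.eventually_ge_atTop K, hwin.eventually hL,
      hwin.eventually (hg.eventually (Filter.eventually_ge_atTop (2 ^ K)))] with N h1 h2 h3 h4
    have := h3 (2 ^ K) (2 ^ K) Nat.one_le_two_pow h4 h4
    exact ⟨h1, h2, this⟩
  obtain ⟨N₀, hN₀⟩ := Filter.eventually_atTop.1 hgood
  obtain ⟨A, p, hA⟩ := exists_distinguisher L K n θ R N₀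
  have hfloor : ∀ N : ℕ, ⌊(N : ℝ) ^ (s : ℝ)⌋₊ = N ^ s := fun N => by
    rw [Real.rpow_natCast, ← Nat.cast_pow, Nat.floor_natCast]
  set q : Polynomial ℕ := Polynomial.C R * ((L.samples.comp (windowPoly K)) * Polynomial.C K +
    L.coins.comp (windowPoly K)) with hq
  have hqe : ∀ N, q.eval N = R * (L.samples.eval (window K N) * K + L.coins.eval (window K N)) :=
    fun N => by simp [hq, Polynomial.eval_comp, eval_windowPoly]
  have hcond : ∀ (N : ℕ) (G : Hypergraph N ⌊(N : ℝ) ^ (s : ℝ)⌋₊ K)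
      (y : Fin ⌊(N : ℝ) ^ (s : ℝ)⌋₊ → Bool) (r : Fin (q.eval N) → Bool), N₀ < N →
      R * (L.samples.eval (window K N) + n) ≤ (List.ofFn fun i => (G i, y i)).length ∧
        R * (L.samples.eval (window K N) * K + L.coins.eval (window K N)) ≤ (List.ofFn r).length ∧
        L.RunsInTime (window K N) (2 ^ K) (2 ^ K) := by
    intro N G y r hN
    obtain ⟨h1, _, h2, _⟩ := hN₀ N hN.le
    rw [List.length_ofFn, List.length_ofFn, hfloor, hqe]
    exact ⟨h1, le_rfl, h2⟩
  have hfin := hP A q p fun N G y r => by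
    rw [prgInput_eq]
    exact (hA N _ _ (hcond N G y r)).1
  obtain ⟨N, hN, hN1⟩ := (hfin.and (Filter.eventually_gt_atTop N₀)).exists
  obtain ⟨h1, h2, _, h4⟩ := hN₀ N hN1.le
  have hne : Nonempty (Fin K ↪ Fin N) := ⟨Fin.castLEEmb h2⟩
  have hout : ∀ (G : Hypergraph N ⌊(N : ℝ) ^ (s : ℝ)⌋₊ K)
      (y : Fin ⌊(N : ℝ) ^ (s : ℝ)⌋₊ → Bool) (r : Fin (q.eval N) → Bool),
      (A.output (prgInput G y r) (p.eval N) = [true]) =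
        (acceptsSome L θ (L.samples.eval (window K N)) n (L.coins.eval (window K N)) R
          (List.ofFn fun i => (G i, y i)) (List.ofFn r) = true) := by
    intro G y r
    rw [prgInput_eq]
    exact propext ((hA N _ _ (hcond N G y r)).2 hN1)
  simp only [hout] at hN
  rw [hqe] at hN
  rw [← hfloor] at h1
  have hreal := uprob_goldreich_ge P L hδ hδ' h4 (θ := θ) (n := n) (R := R) (fun p X hX =>
    hn₁ n (le_max_left _ _) _ p X hX (n - θ) (by
      have : (n : ℝ) ≤ (n - θ : ℕ) + θ := by
        exact_mod_cast (show n ≤ (n - θ) + θ by omega)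
      linarith)) h1
  have hrand := uprob_labels_le L hτ0.le hτ1 (θ := θ) (n := n) (R := R) (K := K) (N := N)
    (fun p X hX => hn₂ n (le_max_right _ _) _ p X hX (θ + 1) (by push_cast; linarith)) h1
  have := (abs_le.1 hN).2
  linarith

end Thinkers

theorem mainTheorem5 (hPRG : Thinkers.LocalPRGsExist) (g : ℕ → ℕ) (hmono : Monotone g)
    (hg : Filter.Tendsto g Filter.atTop Filter.atTop) (hcomp : Thinkers.PolyTimeComputable g) :
    ¬ ∃ L : Thinkers.Learner, L.WeaklyLearns g := by
  rintro ⟨L, hL⟩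
  exact hPRG.not_weaklyLearns hg L hL
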